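/- Let $0<q<1$, let $t\in\mathbb R$ with $|t|>1$, and let $\theta\in\mathbb R$. Let $A_q(SU(1,1))$ be the unital complex algebra generated by $\alpha,\beta,\gamma,\delta$ with relations $\alpha\beta=q\beta\alpha$, $\alpha\gamma=q\gamma\alpha$, $\beta\delta=q\delta\beta$, $\gamma\delta=q\delta\gamma$, $\beta\gamma=\gamma\beta$, $\alpha\delta-q\beta\gamma=\delta\alpha-q^{-1}\beta\gamma=1$ (with $\alpha^*=\delta$, $\gamma^*=q^{-1}\beta$), and let $\pi_{e^{i\theta}}$ be its representation on the finite linear combinations of the standard basis vectors $e_k$ ($k\in\mathbb Z$) of $\ell^2(\mathbb Z)$ given by $$\pi_{e^{i\theta}}(\alpha)e_k=\sqrt{1+q^{-2k}}\,e_{k+1},\quad \pi_{e^{i\theta}}(\gamma)e_k=e^{i\theta}q^{-k}e_k,\quad \pi_{e^{i\theta}}(\delta)e_k=\sqrt{1+q^{2-2k}}\,e_{k-1},\quad \pi_{e^{i\theta}}(\beta)e_k=q\,e^{-i\theta}q^{-k}e_k .$$ Put $$\alpha_{\infty,t}=q^{1/2}\alpha+q^{-1/2}t\beta,\quad \beta_{\infty,t}=q^{1/2}t\alpha+q^{-1/2}\beta,\quad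 \gamma_{\infty,t}=q^{1/2}\gamma+q^{-1/2}t\delta,\quad \delta_{\infty,t}=q^{1/2}t\gamma+q^{-1/2}\delta,$$ and $\mathcal D(Q)=\{\sum_k c_ke_k\in\ell^2(\mathbb Z)\mid\sum_k|c_k|^2q^{-2k}<\infty\}$. For $x,s\in\mathbb R\setminus\{0\}$ with $|s|>q$ and $k\in\mathbb Z$ let $$V_k(x;s)=(-q^{2-2k};q^2)_\infty^{1/2}\,q^{\frac12k(k+1)}(-s)^{-k}\,{}_1\varphi_1\bigl(-(xs)^{-1};q^2s^{-2};q^2,xq^{2k+2}s^{-1}\bigr),$$ where $(a;q)_n=\prod_{i=0}^{n-1}(1-aq^i)$ for $n\in\mathbb Z_{\ge0}\cup\{\infty\}$ and ${}_1\varphi_1(a;b;q,z)=\sum_{n\ge0}\frac{(a;q)_n}{(q;q)_n(b;q)_n}(-1)^nq^{n(n-1)/2}z^n$, and let $$v^\theta_p(s)=\sum_{k\in\mathbb Z}e^{ik\theta}V_k(-q^{2p}s^{-1};s)\,e_k\ (p\in\mathbb Z_{\ge0}),\qquad w^\theta_p(s)=\sum_{k\in\mathbb Z}e^{ik\theta}V_k(q^{2p}s;s)\,e_k\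 (p\in\mathbb Z).$$ Then $v^\theta_p(s),w^\theta_p(s)\in\ell^2(\mathbb Z)$ whenever $s\in\mathbb R$, $|s|>q$. For each $a\in\{\alpha_{\infty,t},\beta_{\infty,t},\gamma_{\infty,t},\delta_{\infty,t}\}$ the operator $\pi_{e^{i\theta}}(a)$ is defined on $\mathcal D(Q)$ by the same formula, that is, $\pi_{e^{i\theta}}(a)\sum_kc_ke_k=\sum_kc_k\,\pi_{e^{i\theta}}(a)e_k$ with convergence in $\ell^2(\mathbb Z)$. The vectors $v^\theta_p(t)$ $(p\in\mathbb Z_{\ge0})$ and $w^\theta_p(t)$ $(p\in\mathbb Z)$ lie in $\mathcal D(Q)$, and, for all $p\in\mathbb Z_{\ge0}$ in the formulas for $v$ and all $p\in\mathbb Z$ in the formulas for $w$, $$\begin{aligned} \pi_{e^{i\theta}}(\alpha_{\infty,t})v^\theta_p(t)&=q^{1/2}e^{-i\theta}t^{-1}\frac{1-q^{2p}}{1-q^2t^{-2}}\,v^\theta_{p-1}(tq^{-1}),& \pi_{e^{i\theta}}(\alpha_{\infty,t})w^\theta_p(t)&=q^{1/2}e^{-i\theta}t^{-1}\frac{1+t^2q^{2p}}{1-q^2t^{-2}}\,w^\theta_p(tq^{-1}),\\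 \pi_{e^{i\theta}}(\beta_{\infty,t})v^\theta_p(t)&=-t^2q^{1/2}e^{-i\theta}(1-t^{-2})\,v^\theta_p(tq),& \pi_{e^{i\theta}}(\beta_{\infty,t})w^\theta_p(t)&=-t^2q^{1/2}e^{-i\theta}(1-t^{-2})\,w^\theta_{p-1}(tq),\\ \pi_{e^{i\theta}}(\gamma_{\infty,t})v^\theta_p(t)&=-q^{1/2}e^{i\theta}\frac{1-q^{2+2p}t^{-2}}{1-q^2t^{-2}}\,v^\theta_p(tq^{-1}),& \pi_{e^{i\theta}}(\gamma_{\infty,t})w^\theta_p(t)&=-q^{1/2}e^{i\theta}\frac{1+q^{2+2p}}{1-q^2t^{-2}}\,w^\theta_{p+1}(tq^{-1}),\\ \pi_{e^{i\theta}}(\delta_{\infty,t})v^\theta_p(t)&=e^{i\theta}tq^{1/2}(1-t^{-2})\,v^\theta_{p+1}(tq),& \pi_{e^{i\theta}}(\delta_{\infty,t})w^\theta_p(t)&=e^{i\theta}tq^{1/2}(1-t^{-2})\,w^\theta_p(tq), \end{aligned}$$ where for $p=0$ the right-hand side of the first formula is $0$. -/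

import Mathlib

noncomputable section

namespace QSU11

/-! ### `q`-shifted factorials and the basic hypergeometric series `₁φ₁` -/

/-- `(a; q)_n = ∏_{i < n} (1 - a q^i)`. -/
def qPoch (a q : ℝ) (n : ℕ) : ℝ := ∏ i ∈ Finset.range n, (1 - a * q ^ i)

/-- `(a; q)_∞ = ∏_{i ≥ 0} (1 - a q^i)`. -/
def qPochInf (a q : ℝ) : ℝ := ∏' i : ℕ, (1 - a * q ^ i)

/-- `₁φ₁(a; b; q, z) = ∑_n (a;q)_n z^n / ((q;q)_n (b;q)_n) · (-1)^n q^{n(n-1)/2}`. -/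
def phi11 (a b q z : ℝ) : ℝ :=
  ∑' n : ℕ, qPoch a q n * z ^ n / (qPoch q q n * qPoch b q n) *
    ((-1) ^ n * q ^ (n * (n - 1) / 2))

/-! ### The algebra `A_q(SU(1,1))` -/

/-- The four generators `α, β, γ, δ`. -/
inductive Gen
  | a | b | c | d

/-- The defining relations. -/
inductive Rel (q : ℝ) : FreeAlgebra ℂ Gen → FreeAlgebra ℂ Gen → Prop
  | ab : Rel q (FreeAlgebra.ι ℂ Gen.a * FreeAlgebra.ι ℂ Gen.b)
      ((q : ℂ) • (FreeAlgebra.ι ℂ Gen.b * FreeAlgebra.ι ℂ Gen.a))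
  | ac : Rel q (FreeAlgebra.ι ℂ Gen.a * FreeAlgebra.ι ℂ Gen.c)
      ((q : ℂ) • (FreeAlgebra.ι ℂ Gen.c * FreeAlgebra.ι ℂ Gen.a))
  | bd : Rel q (FreeAlgebra.ι ℂ Gen.b * FreeAlgebra.ι ℂ Gen.d)
      ((q : ℂ) • (FreeAlgebra.ι ℂ Gen.d * FreeAlgebra.ι ℂ Gen.b))
  | cd : Rel q (FreeAlgebra.ι ℂ Gen.c * FreeAlgebra.ι ℂ Gen.d)
      ((q : ℂ) • (FreeAlgebra.ι ℂ Gen.d * FreeAlgebra.ι ℂ Gen.c))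
  | bc : Rel q (FreeAlgebra.ι ℂ Gen.b * FreeAlgebra.ι ℂ Gen.c)
      (FreeAlgebra.ι ℂ Gen.c * FreeAlgebra.ι ℂ Gen.b)
  | det : Rel q (FreeAlgebra.ι ℂ Gen.a * FreeAlgebra.ι ℂ Gen.d
      - (q : ℂ) • (FreeAlgebra.ι ℂ Gen.b * FreeAlgebra.ι ℂ Gen.c)) 1
  | det' : Rel q (FreeAlgebra.ι ℂ Gen.d * FreeAlgebra.ι ℂ Gen.a
      - (q : ℂ)⁻¹ • (FreeAlgebra.ι ℂ Gen.b * FreeAlgebra.ι ℂ Gen.c)) 1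

/-- The unital complex algebra `A_q(SL(2,ℂ))`, which is the algebra underlying the `*`-algebra
`A_q(SU(1,1))`, whose involution is given by `α* = δ`, `β* = qγ`, `γ* = q⁻¹β`, `δ* = α`. -/
abbrev Aq (q : ℝ) : Type := RingQuot (Rel q)

/-- The class of a generator in `A_q`. -/
def gen (q : ℝ) (g : Gen) : Aq q := RingQuot.mkAlgHom ℂ (Rel q) (FreeAlgebra.ι ℂ g)

/-- `α_{∞,t} = q^{1/2} α + q^{-1/2} t β`. -/
def alphaInf (q t : ℝ) : Aq q :=
  ((q ^ (1 / 2 : ℝ) : ℝ) : ℂ) • gen q Gen.a + ((q ^ (-1 / 2 : ℝ) * t : ℝ) : ℂ) • gen q Gen.b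

/-- `β_{∞,t} = q^{1/2} t α + q^{-1/2} β`. -/
def betaInf (q t : ℝ) : Aq q :=
  ((q ^ (1 / 2 : ℝ) * t : ℝ) : ℂ) • gen q Gen.a + ((q ^ (-1 / 2 : ℝ) : ℝ) : ℂ) • gen q Gen.b

/-- `γ_{∞,t} = q^{1/2} γ + q^{-1/2} t δ`. -/
def gammaInf (q t : ℝ) : Aq q :=
  ((q ^ (1 / 2 : ℝ) : ℝ) : ℂ) • gen q Gen.c + ((q ^ (-1 / 2 : ℝ) * t : ℝ) : ℂ) • gen q Gen.d

/-- `δ_{∞,t} = q^{1/2} t γ + q^{-1/2} δ`. -/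
def deltaInf (q t : ℝ) : Aq q :=
  ((q ^ (1 / 2 : ℝ) * t : ℝ) : ℂ) • gen q Gen.c + ((q ^ (-1 / 2 : ℝ) : ℝ) : ℂ) • gen q Gen.d

/-! ### The representation `π_λ` on finite linear combinations of the `e_k` -/

/-- The space `𝒟(ℤ)` of finite linear combinations of the basis vectors `e_k`, `k ∈ ℤ`. -/
abbrev DZ : Type := ℤ →₀ ℂ

/-- The action of the generators (recall `δ = α*` and `β = qγ*`):
`α e_k = √(1 + |λ|² q^{-2k}) e_{k+1}`, `γ e_k = λ q^{-k} e_k`,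
`δ e_k = √(1 + |λ|² q^{2-2k}) e_{k-1}`, `β e_k = q · conj(λ) q^{-k} e_k`. -/
def genAct (q : ℝ) (l : ℂ) : Gen → Module.End ℂ DZ
  | Gen.a => Finsupp.linearCombination ℂ fun k : ℤ =>
      Finsupp.single (k + 1) ((Real.sqrt (1 + ‖l‖ ^ 2 * q ^ (-2 * k)) : ℝ) : ℂ)
  | Gen.b => Finsupp.linearCombination ℂ fun k : ℤ =>
      Finsupp.single k ((q : ℂ) * ((starRingEnd ℂ) l * (q : ℂ) ^ (-k)))
  | Gen.c => Finsupp.linearCombination ℂ fun k : ℤ =>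
      Finsupp.single k (l * (q : ℂ) ^ (-k))
  | Gen.d => Finsupp.linearCombination ℂ fun k : ℤ =>
      Finsupp.single (k - 1) ((Real.sqrt (1 + ‖l‖ ^ 2 * q ^ (2 - 2 * k)) : ℝ) : ℂ)

theorem genAct_rel {q : ℝ} (hq : 0 < q) (l : ℂ) {x y : FreeAlgebra ℂ Gen} (h : Rel q x y) :
    FreeAlgebra.lift ℂ (genAct q l) x = FreeAlgebra.lift ℂ (genAct q l) y := by
  have hq' : (q : ℂ) ≠ 0 := by exact_mod_cast hq.ne'
  have hsq : ∀ k : ℤ, ((Real.sqrt (1 + ‖l‖ ^ 2 * q ^ k) : ℝ) : ℂ) *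
      ((Real.sqrt (1 + ‖l‖ ^ 2 * q ^ k) : ℝ) : ℂ) = 1 + l * (starRingEnd ℂ) l * (q : ℂ) ^ k := by
    intro k
    rw [← Complex.ofReal_mul, Real.mul_self_sqrt (by positivity), Complex.mul_conj,
      Complex.normSq_eq_norm_sq]
    push_cast
    ring
  have e1 : ∀ k : ℤ, 2 - 2 * (k + 1) = -2 * k := fun k => by ring
  have e2 : ∀ k : ℤ, -2 * (k - 1) = 2 - 2 * k := fun k => by ring
  have z1 : ∀ k : ℤ, (q : ℂ) ^ (-2 * k) = (q : ℂ) ^ (-k) * (q : ℂ) ^ (-k) := fun k => by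
    rw [← zpow_add₀ hq']; congr 1; ring
  have z2 : ∀ k : ℤ, (q : ℂ) ^ (2 - 2 * k) = (q : ℂ) ^ 2 * ((q : ℂ) ^ (-k) * (q : ℂ) ^ (-k)) :=
    fun k => by
      rw [← zpow_add₀ hq', ← zpow_natCast (q : ℂ) 2, ← zpow_add₀ hq']; congr 1; push_cast; ring
  have z3 : ∀ k : ℤ, (q : ℂ) * (q : ℂ) ^ (-(k + 1)) = (q : ℂ) ^ (-k) := fun k => by
    rw [← zpow_one_add₀ hq']; congr 1; ring
  have z4 : ∀ k : ℤ, (q : ℂ) ^ (-(k - 1)) = (q : ℂ) * (q : ℂ) ^ (-k) := fun k => by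
    rw [← zpow_one_add₀ hq']; congr 1; ring
  cases h <;> refine Finsupp.lhom_ext' fun k => LinearMap.ext_ring ?_ <;>
    simp only [map_mul, map_sub, map_smul, map_one, FreeAlgebra.lift_ι_apply,
      LinearMap.comp_apply, Finsupp.lsingle_apply, Module.End.mul_apply, LinearMap.sub_apply,
      LinearMap.smul_apply, Module.End.one_apply, genAct, Finsupp.linearCombination_single,
      one_smul, Finsupp.smul_single, smul_eq_mul, ← Finsupp.single_sub, add_sub_cancel_right,
      sub_add_cancel] <;> congr 1
  · linear_combination (-(Real.sqrt (1 + ‖l‖ ^ 2 * q ^ (-2 * k)) : ℂ) * (starRingEnd ℂ) l * q) * z3 k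
  · linear_combination (-(Real.sqrt (1 + ‖l‖ ^ 2 * q ^ (-2 * k)) : ℂ) * l) * z3 k
  · rw [z4]; ring
  · rw [z4]; ring
  · ring
  · rw [e2, hsq, z2]; ring
  · rw [e1, hsq, z1]; field_simp; ring

/-- The representation `π_λ` of `A_q(SU(1,1))` by linear operators on `𝒟(ℤ)`. -/
def rep {q : ℝ} (hq : 0 < q) (l : ℂ) : Aq q →ₐ[ℂ] Module.End ℂ DZ :=
  RingQuot.liftAlgHom ℂ ⟨FreeAlgebra.lift ℂ (genAct q l), fun _ _ h => genAct_rel hq l h⟩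

theorem rep_gen {q : ℝ} (hq : 0 < q) (l : ℂ) (g : Gen) :
    rep hq l (gen q g) = genAct q l g := by
  simp [rep, gen]

/-! ### Operators on `ℓ²(ℤ)` -/

/-- The Hilbert space `ℓ²(ℤ)`. -/
abbrev L2Z : Type := lp (fun _ : ℤ => ℂ) 2

/-- The standard orthonormal basis vector `e_k` of `ℓ²(ℤ)`. -/
def basisVec (k : ℤ) : L2Z := lp.single 2 k (1 : ℂ)

/-- The inclusion of `𝒟(ℤ)` in `ℓ²(ℤ)`. -/
def incl : DZ →ₗ[ℂ] L2Z := Finsupp.linearCombination ℂ basisVec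

/-- `𝒟(Q) = {∑ c_k e_k ∈ ℓ²(ℤ) | ∑ |c_k|² q^{-2k} < ∞}`. -/
def DQ (q : ℝ) : Submodule ℂ L2Z where
  carrier := {c | Summable fun k : ℤ => ‖c k‖ ^ 2 * q ^ (-2 * k)}
  zero_mem' := by
    simp
  add_mem' := by
    intro x y hx hy
    have hpos : ∀ k : ℤ, 0 ≤ q ^ (-2 * k) := fun k => Even.zpow_nonneg ⟨-k, by ring⟩ q
    refine Summable.of_nonneg_of_le (fun k => mul_nonneg (by positivity) (hpos k)) (fun k => ?_)
      ((hx.mul_left 2).add (hy.mul_left 2))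
    have h1 : ‖(x + y) k‖ ≤ ‖x k‖ + ‖y k‖ := norm_add_le _ _
    have h2 : ‖(x + y) k‖ ^ 2 ≤ 2 * ‖x k‖ ^ 2 + 2 * ‖y k‖ ^ 2 := by
      have := pow_le_pow_left₀ (norm_nonneg _) h1 2
      nlinarith [sq_nonneg (‖x k‖ - ‖y k‖)]
    nlinarith [mul_le_mul_of_nonneg_right h2 (hpos k)]
  smul_mem' := by
    intro a x hx
    have h := hx.mul_left (‖a‖ ^ 2)
    refine h.congr fun k => ?_
    have : (a • x) k = a * x k := rfl
    rw [this, norm_mul]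
    ring

/-- An operator `T` on `𝒟(ℤ)` acting by the same formula, `∑ c_k e_k ↦ ∑ c_k T e_k`, on those
elements `∑ c_k e_k` of `𝒟(Q)` for which the series on the right converges in `ℓ²(ℤ)`. -/
def extend (q : ℝ) (T : Module.End ℂ DZ) : L2Z →ₗ.[ℂ] L2Z where
  domain :=
    { carrier := {c | c ∈ DQ q ∧ Summable fun k : ℤ => c k • incl (T (Finsupp.single k 1))}
      zero_mem' := ⟨(DQ q).zero_mem, by
        simp⟩
      add_mem' := by
        intro x y hx hy
        refine ⟨(DQ q).add_mem hx.1 hy.1, (hx.2.add hy.2).congr fun k => ?_⟩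
        exact (add_smul _ _ _).symm
      smul_mem' := by
        intro a x hx
        refine ⟨(DQ q).smul_mem a hx.1, (hx.2.const_smul a).congr fun k => ?_⟩
        exact smul_smul _ _ _ }
  toFun :=
    { toFun := fun c => ∑' k : ℤ, (c : L2Z) k • incl (T (Finsupp.single k 1))
      map_add' := by
        intro x y
        rw [← x.2.2.tsum_add y.2.2]
        exact tsum_congr fun k => add_smul _ _ _
      map_smul' := by
        intro a x
        rw [RingHom.id_apply, ← x.2.2.tsum_const_smul a]
        exact tsum_congr fun k => (smul_smul a _ _).symm }

/-- The unbounded operator `π_{e^{iθ}}(a)` on `ℓ²(ℤ)`, for `a ∈ A_q(SU(1,1))`, extended from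
`𝒟(ℤ)` to (the part where the series converges of) `𝒟(Q)`. -/
def piOp {q : ℝ} (hq : 0 < q) (θ : ℝ) (a : Aq q) : L2Z →ₗ.[ℂ] L2Z :=
  extend q (rep hq (Complex.exp (Complex.I * θ)) a)

/-! ### The vectors `v^θ_p(t)` and `w^θ_p(t)` -/

/-- `V_k(x;t) = (-q^{2-2k};q²)_∞^{1/2} q^{k(k+1)/2} (-t)^{-k}
  ₁φ₁(-(xt)⁻¹; q² t⁻²; q², x q^{2k+2} t⁻¹)`. -/
def V (q : ℝ) (k : ℤ) (x t : ℝ) : ℝ :=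
  Real.sqrt (qPochInf (-q ^ (2 - 2 * k)) (q ^ 2)) * q ^ ((1 / 2 : ℝ) * k * (k + 1)) *
    (-t) ^ (-k) * phi11 (-(x * t)⁻¹) (q ^ 2 * t ^ (-2 : ℤ)) (q ^ 2) (x * q ^ (2 * k + 2) * t⁻¹)

/-- The coefficients `e^{ikθ} V_k(x;t)`, `k ∈ ℤ`. -/
def coeffs (q θ x t : ℝ) : ℤ → ℂ :=
  fun k => Complex.exp (Complex.I * k * θ) * (V q k x t : ℂ)

open Classical in
/-- The element `∑ c_k e_k` of `ℓ²(ℤ)`; it is set to `0` if `c` is not square summable. -/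
def ofCoeffs (c : ℤ → ℂ) : L2Z := if h : Memℓp c 2 then ⟨c, h⟩ else 0

/-- `v^θ_p(t) = ∑_k e^{ikθ} V_k(-q^{2p} t⁻¹; t) e_k`. -/
def v (q θ : ℝ) (p : ℤ) (t : ℝ) : L2Z := ofCoeffs (coeffs q θ (-q ^ (2 * p) * t⁻¹) t)

/-- `w^θ_p(t) = ∑_k e^{ikθ} V_k(q^{2p} t; t) e_k`. -/
def w (q θ : ℝ) (p : ℤ) (t : ℝ) : L2Z := ofCoeffs (coeffs q θ (q ^ (2 * p) * t) t)

/-- `x` lies in the domain of the partially defined operator `T`, and `T x = y`. -/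
def MapsVec (T : L2Z →ₗ.[ℂ] L2Z) (x y : L2Z) : Prop :=
  ∃ h : x ∈ T.domain, T ⟨x, h⟩ = y

end QSU11

end

noncomputable section

namespace QSU11

open Filter Topology

/-! ### The series `₁φ₁` and its contiguous relations -/

/-! Each of the four operators sends $e_k$ to a combination of $e_k$ and one neighbour $e_{k\pm1}$,
so each formula amounts to a two-term identity between $V_k(x;t)$, $V_{k+1}(x;t)$ and one value of
$V$ at shifted parameters. Put $Q=q^2$, $a=-(xt)^{-1}$, $b=Qt^{-2}$, $z=xq^{2k+2}t^{-1}$. Raising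
$k$ by one sends $z$ to $Qz$. The shifts of $(x,t)$ by $q^{\pm1}$ send $(a,b)$ to $(Qa,Qb)$ for
$\alpha$, $(a,b/Q)$ for $\beta$, $(a,Qb)$ for $\gamma$ and $(a/Q,b/Q)$ for $\delta$. The identities
are therefore contiguous relations of ${}_1\varphi_1$: `phi11_sub_phi11_mul`, `phi11_lower`,
`phi11_raise` and `phi11_lower_both`. The infinite product in $V_k$ supplies the square roots in the
representation, and the phase $e^{ik\theta}$ turns a shift of $k$ into a factor $e^{\pm i\theta}$.

The analytic part is square summability. The squared prefactor of $V_k$ decays faster than any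
geometric sequence as $k\to-\infty$, and like $(q^2/s^2)^k$ as $k\to\infty$ (`summable_wt_term`). So
a bound on ${}_1\varphi_1$ by a power of $1+Q^k$ suffices; it matters only as $k\to-\infty$, where
the argument is unbounded. For $v_p$ the series terminates because $a=Q^{-p}$. For $w_p$ the
argument runs over integer powers of $Q$. Heine's transformation writes ${}_1\varphi_1$, when
$|a|<1$, as an absolutely convergent combination of values of
${}_1\varphi_1(0;0;Q,\cdot)=(\cdot\,;Q)_\infty$ on this lattice, where that function is bounded
because it vanishes at $Q^{-j}$, $j\ge0$. The relation `phi11_lower_both` then carries bounds from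
$(Qa,Qb)$ to $(a,b)$, which removes the restriction $|a|<1$. -/

theorem summable_of_ratio_tendsto {f g : ℕ → ℝ} {l : ℝ} (h : ∀ n, f (n + 1) = f n * g n)
    (hg : Tendsto g atTop (𝓝 l)) (hl : |l| < 1) : Summable f := by
  obtain ⟨r, hr, hr1⟩ := exists_between hl
  refine summable_of_ratio_norm_eventually_le hr1 ?_
  filter_upwards [hg.abs.eventually (gt_mem_nhds hr)] with n hn
  rw [h, norm_mul, mul_comm]
  exact mul_le_mul_of_nonneg_right hn.le (norm_nonneg _)

theorem qPoch_zero (a q : ℝ) : qPoch a q 0 = 1 := by simp [qPoch]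

theorem qPoch_succ (a q : ℝ) (n : ℕ) : qPoch a q (n + 1) = qPoch a q n * (1 - a * q ^ n) :=
  Finset.prod_range_succ _ _

theorem qPoch_succ' (a q : ℝ) (n : ℕ) : qPoch a q (n + 1) = (1 - a) * qPoch (a * q) q n := by
  rw [qPoch, Finset.prod_range_succ', mul_comm]
  simp only [pow_zero, mul_one, qPoch]
  congr 1
  exact Finset.prod_congr rfl fun i _ => by ring

theorem one_sub_mul_pow_ne_zero {b q : ℝ} (hq : 0 < q) (hq1 : q < 1) (hb : |b| < 1) (n : ℕ) :
    1 - b * q ^ n ≠ 0 := by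
  have h : |b * q ^ n| < 1 := by
    rw [abs_mul, abs_of_pos (pow_pos hq n)]
    exact mul_lt_one_of_nonneg_of_lt_one_left (abs_nonneg _) hb (pow_le_one₀ hq.le hq1.le)
  have := (abs_lt.1 h).2
  exact (sub_pos.2 this).ne'

theorem qPoch_ne_zero {b q : ℝ} (hq : 0 < q) (hq1 : q < 1) (hb : |b| < 1) (n : ℕ) :
    qPoch b q n ≠ 0 :=
  Finset.prod_ne_zero_iff.2 fun i _ => one_sub_mul_pow_ne_zero hq hq1 hb i

theorem abs_mul_lt_one {b q : ℝ} (hq : 0 < q) (hq1 : q < 1) (hb : |b| < 1) : |b * q| < 1 := by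
  rw [abs_mul, abs_of_pos hq]
  exact mul_lt_one_of_nonneg_of_lt_one_left (abs_nonneg _) hb hq1.le

/-- The `n`-th term of the series defining `phi11`. -/
def phiTerm (a b q z : ℝ) (n : ℕ) : ℝ :=
  qPoch a q n * z ^ n / (qPoch q q n * qPoch b q n) * ((-1) ^ n * q ^ (n * (n - 1) / 2))

theorem phi11_eq_tsum (a b q z : ℝ) : phi11 a b q z = ∑' n, phiTerm a b q z n := rfl

theorem phiTerm_zero (a b q z : ℝ) : phiTerm a b q z 0 = 1 := by simp [phiTerm, qPoch]

theorem phiTerm_mul (a b q z : ℝ) (n : ℕ) :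
    phiTerm a b q (q * z) n = q ^ n * phiTerm a b q z n := by
  simp only [phiTerm, mul_pow]; ring

theorem neg_one_pow_mul_pow_triangle_succ (q : ℝ) (n : ℕ) :
    (-1 : ℝ) ^ (n + 1) * q ^ ((n + 1) * (n + 1 - 1) / 2) =
      -q ^ n * ((-1) ^ n * q ^ (n * (n - 1) / 2)) := by
  rw [Nat.triangle_succ, pow_add, pow_succ]; ring

theorem phiTerm_succ {a b q z : ℝ} (hq : 0 < q) (hq1 : q < 1) (hb : |b| < 1) (n : ℕ) :
    phiTerm a b q z (n + 1) = phiTerm a b q z n *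
      (-((1 - a * q ^ n) * z * q ^ n) / ((1 - q * q ^ n) * (1 - b * q ^ n))) := by
  have h1 := qPoch_ne_zero hq hq1 hb n
  have h2 := qPoch_ne_zero hq hq1 (abs_lt.2 ⟨by linarith, hq1⟩) n
  have h3 := one_sub_mul_pow_ne_zero hq hq1 hb n
  have h4 := one_sub_mul_pow_ne_zero hq hq1 (abs_lt.2 ⟨by linarith, hq1⟩) n
  simp only [phiTerm, neg_one_pow_mul_pow_triangle_succ, qPoch_succ, pow_succ z]
  field_simp

theorem phiTerm_succ' {a b q z : ℝ} (hq : 0 < q) (hq1 : q < 1) (hb : |b| < 1) (n : ℕ) :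
    (1 - b) * (1 - q * q ^ n) * phiTerm a b q z (n + 1) =
      -z * (1 - a) * phiTerm (a * q) (b * q) q (q * z) n := by
  have h1 := qPoch_ne_zero hq hq1 (abs_mul_lt_one hq hq1 hb) n
  have h2 := qPoch_ne_zero hq hq1 (abs_lt.2 ⟨by linarith, hq1⟩) n
  have h3 : 1 - b ≠ 0 := by simpa using one_sub_mul_pow_ne_zero hq hq1 hb 0
  have h4 := one_sub_mul_pow_ne_zero hq hq1 (abs_lt.2 ⟨by linarith, hq1⟩) n
  rw [phiTerm_mul]
  simp only [phiTerm, neg_one_pow_mul_pow_triangle_succ, qPoch_succ' a, qPoch_succ' b,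
    qPoch_succ q, pow_succ z]
  field_simp

theorem phiTerm_lower {a b q z : ℝ} (hq : 0 < q) (hq1 : q < 1) (hb : |b| < 1) (n : ℕ) :
    (1 - b * q ^ n) * phiTerm a (b * q) q z n = (1 - b) * phiTerm a b q z n := by
  have h1 := qPoch_ne_zero hq hq1 (abs_mul_lt_one hq hq1 hb) n
  have h5 := qPoch_ne_zero hq hq1 hb n
  have h2 := qPoch_ne_zero hq hq1 (abs_lt.2 ⟨by linarith, hq1⟩) n
  have h6 := (qPoch_succ b q n).symm.trans (qPoch_succ' b q n)
  simp only [phiTerm]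
  field_simp
  linear_combination (qPoch a q n * z ^ n) * h6

theorem tendsto_pow_zero {q : ℝ} (hq : 0 < q) (hq1 : q < 1) :
    Tendsto (fun n : ℕ => q ^ n) atTop (𝓝 0) :=
  tendsto_pow_atTop_nhds_zero_of_lt_one hq.le hq1

theorem tendsto_one_sub_mul_pow {q : ℝ} (hq : 0 < q) (hq1 : q < 1) (c : ℝ) :
    Tendsto (fun n : ℕ => 1 - c * q ^ n) atTop (𝓝 1) := by
  simpa using ((tendsto_pow_zero hq hq1).const_mul c).const_sub 1

theorem summable_phiTerm {b q : ℝ} (hq : 0 < q) (hq1 : q < 1) (hb : |b| < 1) (a z : ℝ) :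
    Summable (phiTerm a b q z) := by
  refine summable_of_ratio_tendsto (phiTerm_succ hq hq1 hb) (l := 0) ?_ (by simp)
  have h := (((tendsto_one_sub_mul_pow hq hq1 a).mul_const z).mul (tendsto_pow_zero hq hq1)).neg.div
    ((tendsto_one_sub_mul_pow hq hq1 q).mul (tendsto_one_sub_mul_pow hq hq1 b)) (by simp)
  simpa only [mul_zero, neg_zero, zero_div, Pi.div_def] using h

/-- In a functional equation of a power series, a factor $z$ shifts the index by one; this turns a
comparison of coefficients into an identity of sums. -/
theorem tsum_add_tsum_eq_of_shift {A B R : ℕ → ℝ} (hA : Summable A) (hB : Summable B)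
    (hR : Summable R) (h0 : A 0 = R 0) (h : ∀ n, A (n + 1) + B n = R (n + 1)) :
    ∑' n, A n + ∑' n, B n = ∑' n, R n := by
  rw [hA.tsum_eq_zero_add, hR.tsum_eq_zero_add, ← tsum_congr h, h0,
    ((summable_nat_add_iff 1).2 hA).tsum_add hB]
  ring

/-- The relation behind $\alpha$. The difference multiplies the $n$-th term by $1-q^n$, which kills
$n=0$ and cancels the last factor of $(q;q)_n$; reindexing leaves the series with both parameters
raised. -/
theorem phi11_sub_phi11_mul {a b q z : ℝ} (hq : 0 < q) (hq1 : q < 1) (hb : |b| < 1) :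
    (1 - b) * (phi11 a b q z - phi11 a b q (q * z)) =
      -z * (1 - a) * phi11 (a * q) (b * q) q (q * z) := by
  have hs := summable_phiTerm hq hq1 hb a z
  have hs' := summable_phiTerm hq hq1 hb a (q * z)
  have hb' := abs_mul_lt_one hq hq1 hb
  simp only [phi11_eq_tsum]
  rw [← hs.tsum_sub hs', ← tsum_mul_left, ← tsum_mul_left,
    ((hs.sub hs').mul_left _).tsum_eq_zero_add]
  simp only [phiTerm_zero, sub_self, mul_zero, zero_add]
  refine tsum_congr fun n => ?_
  rw [← phiTerm_succ' hq hq1 hb, phiTerm_mul]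
  ring

/-- The relation behind $\beta$. It holds term by term, from $(1-b)(bq;q)_n=(b;q)_n(1-bq^n)$. -/
theorem phi11_lower {a b q z : ℝ} (hq : 0 < q) (hq1 : q < 1) (hb : |b| < 1) :
    phi11 a (b * q) q z - b * phi11 a (b * q) q (q * z) = (1 - b) * phi11 a b q z := by
  have hb' := abs_mul_lt_one hq hq1 hb
  simp only [phi11_eq_tsum]
  rw [← tsum_mul_left, ← tsum_mul_left,
    ← (summable_phiTerm hq hq1 hb' a z).tsum_sub ((summable_phiTerm hq hq1 hb' a _).mul_left b)]
  refine tsum_congr fun n => ?_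
  rw [← phiTerm_lower hq hq1 hb, phiTerm_mul]
  ring

/-- The relation behind $\gamma$, where $b$ is raised and $a$ is kept. -/
theorem phi11_raise {a b q z : ℝ} (hq : 0 < q) (hq1 : q < 1) (hb : |b| < 1) :
    (1 - b) * (b * (phi11 a b q (q * z) - phi11 a b q z) - z * a * phi11 a b q (q * z)) =
      z * (b - a) * phi11 a (b * q) q (q * z) := by
  have hb' := abs_mul_lt_one hq hq1 hb
  have hs := summable_phiTerm hq hq1 hb a z
  have hs' := summable_phiTerm hq hq1 hb a (q * z)
  have hR := (summable_phiTerm hq hq1 hb' a (q * z)).mul_left (z * (b - a))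
  have hA := (hs'.sub hs).mul_left ((1 - b) * b)
  have hB := hs'.mul_left (-((1 - b) * (z * a)))
  -- The explicit factor $z$ pairs the terms of index $n+1$ in the difference with those of index
  -- $n$ elsewhere; the zeroth difference vanishes.
  have key : ∀ n, (1 - b) * b * (phiTerm a b q (q * z) (n + 1) - phiTerm a b q z (n + 1)) +
      -((1 - b) * (z * a)) * phiTerm a b q (q * z) n =
        z * (b - a) * phiTerm a (b * q) q (q * z) n := by
    intro n
    have h3 := one_sub_mul_pow_ne_zero hq hq1 hb n
    have h4 := one_sub_mul_pow_ne_zero hq hq1 (abs_lt.2 ⟨by linarith, hq1⟩) n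
    have hl := phiTerm_lower (a := a) (z := z) hq hq1 hb n
    have hl' : phiTerm a (b * q) q z n = (1 - b) * phiTerm a b q z n / (1 - b * q ^ n) := by
      rw [← hl]; field_simp
    have e1 : (1 - q * q ^ n) * phiTerm a b q z (n + 1) =
        -((1 - a * q ^ n) * z * q ^ n) * phiTerm a b q z n / (1 - b * q ^ n) := by
      rw [phiTerm_succ hq hq1 hb]; field_simp
    have e2 : (1 - b) * b * (q ^ (n + 1) * phiTerm a b q z (n + 1) - phiTerm a b q z (n + 1)) =
        -((1 - b) * b) * ((1 - q * q ^ n) * phiTerm a b q z (n + 1)) := by ring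
    rw [phiTerm_mul, phiTerm_mul, phiTerm_mul, hl', e2, e1]
    field_simp
    ring
  have h0 : (1 - b) * b * (phiTerm a b q (q * z) 0 - phiTerm a b q z 0) = 0 := by
    simp [phiTerm_zero]
  simp only [phi11_eq_tsum]
  rw [← tsum_mul_left (a := z * (b - a)), ← tsum_congr key,
    ((summable_nat_add_iff 1).2 hA).tsum_add hB, tsum_mul_left (f := phiTerm a b q (q * z))]
  have e := hA.tsum_eq_zero_add
  rw [h0, zero_add, tsum_mul_left, hs'.tsum_sub hs] at e
  rw [← e]
  ring

/-- The relation behind $\delta$. It also serves for growth estimates, since it expresses the series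
at $(a,b)$ through the series at $(aq,bq)$ with a coefficient linear in $z$. -/
theorem phi11_lower_both {a b q z : ℝ} (hq : 0 < q) (hq1 : q < 1) (hb : |b| < 1) :
    phi11 (a * q) (b * q) q z - (b - z * a) * phi11 (a * q) (b * q) q (q * z) =
      (1 - b) * phi11 a b q z := by
  have hb' := abs_mul_lt_one hq hq1 hb
  have hs := summable_phiTerm hq hq1 hb' (a * q) z
  have hs' := summable_phiTerm hq hq1 hb' (a * q) (q * z)
  have h := tsum_add_tsum_eq_of_shift (hs.sub (hs'.mul_left b)) (hs'.mul_left (z * a))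
    ((summable_phiTerm hq hq1 hb a z).mul_left (1 - b)) (by simp [phiTerm_zero]) ?_
  · rw [hs.tsum_sub (hs'.mul_left b), tsum_mul_left, tsum_mul_left, tsum_mul_left] at h
    simp only [phi11_eq_tsum]
    linear_combination h
  · intro n
    have h4 := one_sub_mul_pow_ne_zero hq hq1 (abs_lt.2 ⟨by linarith, hq1⟩) n
    have h3 := one_sub_mul_pow_ne_zero hq hq1 hb (n + 1)
    have e1 : b * q * q ^ n = b * q ^ (n + 1) := by ring
    refine mul_left_cancel₀ h4 ?_
    have e := phiTerm_succ' (a := a) (z := z) hq hq1 hb n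
    have e2 : (1 - q * q ^ n) * ((1 - b) * phiTerm a b q z (n + 1)) =
        -z * (1 - a) * (q ^ n * phiTerm (a * q) (b * q) q z n) := by
      rw [← phiTerm_mul, ← e]; ring
    rw [e2, phiTerm_mul, phiTerm_mul, phiTerm_succ hq hq1 hb', e1]
    field_simp
    ring

/-! ### Growth of `₁φ₁` along geometric progressions -/

/-- The functional equation of $(z;q)_\infty$, which replaces the product formula for this series.
-/
theorem phi11_zero_zero {q z : ℝ} (hq : 0 < q) (hq1 : q < 1) :
    phi11 0 0 q z = (1 - z) * phi11 0 0 q (q * z) := by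
  have hb : |(0 : ℝ)| < 1 := by simp
  have hs' := summable_phiTerm hq hq1 hb 0 (q * z)
  have h := tsum_add_tsum_eq_of_shift hs' (hs'.mul_left (-z)) (summable_phiTerm hq hq1 hb 0 z)
    (by simp [phiTerm_zero]) ?_
  · rw [tsum_mul_left] at h
    simp only [phi11_eq_tsum]
    linear_combination -h
  · intro n
    have h4 := one_sub_mul_pow_ne_zero hq hq1 (abs_lt.2 ⟨by linarith, hq1⟩) n
    have e1 : (1 - q * q ^ n) * phiTerm 0 0 q z (n + 1) = -(z * q ^ n) * phiTerm 0 0 q z n := by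
      rw [phiTerm_succ hq hq1 hb]
      simp only [zero_mul, sub_zero, mul_one, one_mul]
      field_simp
    rw [phiTerm_mul, phiTerm_mul]
    linear_combination -e1

theorem phi11_zero_zero_zpow_neg {q : ℝ} (hq : 0 < q) (hq1 : q < 1) (j : ℕ) :
    phi11 0 0 q (q ^ (-(j : ℤ))) = 0 := by
  induction j with
  | zero => rw [phi11_zero_zero hq hq1]; simp
  | succ j ih =>
    have e : q * q ^ (-((j + 1 : ℕ) : ℤ)) = q ^ (-(j : ℤ)) := by
      rw [← zpow_one_add₀ hq.ne']; congr 1; push_cast; ring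
    rw [phi11_zero_zero hq hq1, e, ih, mul_zero]

theorem abs_phi11_le {a b q z : ℝ} (hq : 0 < q) (hq1 : q < 1) (hb : |b| < 1) (hz : |z| ≤ 1) :
    |phi11 a b q z| ≤ ∑' n, |phiTerm a b q 1 n| := by
  rw [phi11_eq_tsum, ← Real.norm_eq_abs]
  refine tsum_of_norm_bounded (summable_phiTerm hq hq1 hb a 1).abs.hasSum fun n => ?_
  have e : phiTerm a b q z n = phiTerm a b q 1 n * z ^ n := by
    simp only [phiTerm, one_pow]; ring
  rw [e, norm_mul, norm_pow, Real.norm_eq_abs, Real.norm_eq_abs]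
  exact mul_le_of_le_one_right (abs_nonneg _) (pow_le_one₀ (abs_nonneg _) hz)

/-- Restricting to integer powers of $q$ is essential: for $|z|\le1$ the series is dominated
termwise, and the lattice points outside the disc are zeros of $(z;q)_\infty$. -/
theorem abs_phi11_zero_zero_zpow_le {q : ℝ} (hq : 0 < q) (hq1 : q < 1) (j : ℤ) :
    |phi11 0 0 q (q ^ j)| ≤ ∑' n, |phiTerm 0 0 q 1 n| := by
  rcases Int.eq_nat_or_neg j with ⟨n, rfl | rfl⟩
  · refine abs_phi11_le hq hq1 (by simp) ?_
    rw [zpow_natCast, abs_of_pos (pow_pos hq n)]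
    exact pow_le_one₀ hq.le hq1.le
  · rw [phi11_zero_zero_zpow_neg hq hq1, abs_zero]
    exact tsum_nonneg fun n => abs_nonneg _

/-- The `m`-th term `(c;q)_m x^m / (q;q)_m` of the `q`-binomial series. -/
def binTerm (c q x : ℝ) (m : ℕ) : ℝ := qPoch c q m * x ^ m / qPoch q q m

/-- The `q`-binomial series `∑_m (c;q)_m x^m / (q;q)_m`. -/
def qBin (c q x : ℝ) : ℝ := ∑' m, binTerm c q x m

theorem binTerm_zero (c q x : ℝ) : binTerm c q x 0 = 1 := by simp [binTerm, qPoch]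

theorem binTerm_mul (c q x y : ℝ) (m : ℕ) : binTerm c q (x * y) m = binTerm c q x m * y ^ m := by
  simp only [binTerm, mul_pow]; ring

theorem binTerm_succ {c q x : ℝ} (hq : 0 < q) (hq1 : q < 1) (m : ℕ) :
    binTerm c q x (m + 1) = binTerm c q x m * ((1 - c * q ^ m) * x / (1 - q * q ^ m)) := by
  have h2 := qPoch_ne_zero hq hq1 (abs_lt.2 ⟨by linarith, hq1⟩) m
  have h4 := one_sub_mul_pow_ne_zero hq hq1 (abs_lt.2 ⟨by linarith, hq1⟩) m
  simp only [binTerm, qPoch_succ, pow_succ x]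
  field_simp

theorem summable_binTerm {q x : ℝ} (hq : 0 < q) (hq1 : q < 1) (hx : |x| < 1) (c : ℝ) :
    Summable (binTerm c q x) := by
  refine summable_of_ratio_tendsto (binTerm_succ hq hq1) (l := x) ?_ hx
  have h := ((tendsto_one_sub_mul_pow hq hq1 c).mul_const x).div
    (tendsto_one_sub_mul_pow hq hq1 q) one_ne_zero
  simpa only [one_mul, div_one, Pi.div_def] using h

/-- Iterating this equation expresses $(x;q)_n/(cx;q)_n$ as a quotient of two values of the
$q$-binomial series, which is all of the $q$-binomial theorem that is needed. -/
theorem qBin_functional {c q x : ℝ} (hq : 0 < q) (hq1 : q < 1) (hx : |x| < 1) :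
    (1 - x) * qBin c q x = (1 - c * x) * qBin c q (x * q) := by
  have hs := summable_binTerm hq hq1 hx c
  have hs' := summable_binTerm hq hq1 (abs_mul_lt_one hq hq1 hx) c
  have h := tsum_add_tsum_eq_of_shift (hs.sub hs')
    ((hs'.mul_left (c * x)).sub (hs.mul_left x)) (R := fun _ => 0) summable_zero
    (by simp [binTerm_zero]) ?_
  · rw [hs.tsum_sub hs', (hs'.mul_left (c * x)).tsum_sub (hs.mul_left x), tsum_mul_left,
      tsum_mul_left, tsum_zero] at h
    simp only [qBin]
    linear_combination h
  · intro n
    have h4 := one_sub_mul_pow_ne_zero hq hq1 (abs_lt.2 ⟨by linarith, hq1⟩) n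
    have e1 : (1 - q * q ^ n) * binTerm c q x (n + 1) =
        (1 - c * q ^ n) * x * binTerm c q x n := by
      rw [binTerm_succ hq hq1]; field_simp
    rw [binTerm_mul, binTerm_mul]
    linear_combination e1

theorem abs_mul_pow_lt_one {b q : ℝ} (hq : 0 < q) (hq1 : q < 1) (hb : |b| < 1) (n : ℕ) :
    |b * q ^ n| < 1 := by
  rw [abs_mul, abs_of_pos (pow_pos hq n)]
  exact mul_lt_one_of_nonneg_of_lt_one_left (abs_nonneg _) hb (pow_le_one₀ hq.le hq1.le)

theorem qBin_mul_pow {c q x : ℝ} (hq : 0 < q) (hq1 : q < 1) (hx : |x| < 1) (hcx : |c * x| < 1)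
    (n : ℕ) : qBin c q (x * q ^ n) = qBin c q x * (qPoch x q n / qPoch (c * x) q n) := by
  induction n with
  | zero => simp [qPoch_zero]
  | succ n ih =>
    have h1 := qPoch_ne_zero hq hq1 hcx n
    have h2 := one_sub_mul_pow_ne_zero hq hq1 hcx n
    have h := qBin_functional (c := c) hq hq1 (abs_mul_pow_lt_one hq hq1 hx n)
    rw [ih, ← mul_assoc c, mul_assoc x (q ^ n) q, ← pow_succ] at h
    refine mul_left_cancel₀ h2 ?_
    rw [← h, qPoch_succ, qPoch_succ]
    generalize c * x = b at *
    generalize q ^ n = y at *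
    rw [mul_div_mul_comm]
    linear_combination (-qBin c q x * (qPoch x q n / qPoch b q n)) * mul_div_cancel₀ (1 - x * y) h2

theorem tendsto_qBin_mul_pow {c q x : ℝ} (hq : 0 < q) (hq1 : q < 1) (hx : |x| < 1) :
    Tendsto (fun n : ℕ => qBin c q (x * q ^ n)) atTop (𝓝 1) := by
  have h := tendsto_tsum_of_dominated_convergence (𝓕 := atTop)
    (f := fun (n m : ℕ) => binTerm c q (x * q ^ n) m)
    (g := fun m => if m = 0 then (1 : ℝ) else 0) (summable_binTerm hq hq1 hx c).abs ?_ ?_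
  · simpa [qBin] using h
  · intro m
    rcases Nat.eq_zero_or_pos m with rfl | hm
    · simp [binTerm_zero]
    · simp only [binTerm_mul, if_neg hm.ne']
      simpa [zero_pow hm.ne'] using
        ((tendsto_pow_zero hq hq1).pow m).const_mul (binTerm c q x m)
  · refine Eventually.of_forall fun n m => ?_
    rw [binTerm_mul, norm_mul, Real.norm_eq_abs, ← pow_mul, Real.norm_eq_abs,
      abs_of_pos (pow_pos hq _)]
    exact mul_le_of_le_one_right (abs_nonneg _) (pow_le_one₀ hq.le hq1.le)

/-- A zero at $x$ would propagate to every $xq^n$, against the limit $1$ as $n\to\infty$. -/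
theorem qBin_ne_zero {c q x : ℝ} (hq : 0 < q) (hq1 : q < 1) (hx : |x| < 1) (hcx : |c * x| < 1) :
    qBin c q x ≠ 0 := by
  intro h0
  have h := tendsto_qBin_mul_pow (c := c) hq hq1 hx
  simp only [qBin_mul_pow hq hq1 hx hcx, h0, zero_mul] at h
  exact zero_ne_one (tendsto_nhds_unique tendsto_const_nhds h)

/-- Heine's transformation of `₁φ₁`. -/
theorem qBin_mul_phi11 {c q x : ℝ} (hq : 0 < q) (hq1 : q < 1) (hx : |x| < 1) (hcx : |c * x| < 1)
    (z : ℝ) : qBin c q x * phi11 x (c * x) q z =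
      ∑' m : ℕ, binTerm c q x m * phi11 0 0 q (z * q ^ m) := by
  have h0 : |(0 : ℝ)| < 1 := by simp
  have hs := summable_phiTerm hq hq1 h0 0 z
  have hg := summable_binTerm hq hq1 hx c
  -- Absolute summability of the double series justifies interchanging the sums; it follows from
  -- $q^{nm}\le1$ and the two single series.
  have hsum : Summable (Function.uncurry fun n m : ℕ =>
      phiTerm 0 0 q z n * (binTerm c q x m * (q ^ n) ^ m)) := by
    refine Summable.of_norm_bounded (summable_mul_of_summable_norm hs.norm hg.norm).norm ?_
    rintro ⟨n, m⟩
    simp only [Function.uncurry, norm_mul]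
    refine mul_le_mul_of_nonneg_left ?_ (norm_nonneg _)
    rw [← pow_mul, Real.norm_eq_abs (q ^ _), abs_of_pos (pow_pos hq _)]
    exact mul_le_of_le_one_right (norm_nonneg _) (pow_le_one₀ hq.le hq1.le)
  have hterm : ∀ n, qBin c q x * phiTerm x (c * x) q z n =
      ∑' m, phiTerm 0 0 q z n * (binTerm c q x m * (q ^ n) ^ m) := by
    intro n
    rw [tsum_mul_left]
    simp only [← binTerm_mul]
    change _ = _ * qBin c q (x * q ^ n)
    have h1 := qPoch_ne_zero hq hq1 hcx n
    have h2 := qPoch_ne_zero hq hq1 (abs_lt.2 ⟨by linarith, hq1⟩) n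
    have h3 : qPoch 0 q n = 1 := by simp [qPoch]
    rw [qBin_mul_pow hq hq1 hx hcx]
    simp only [phiTerm, h3]
    field_simp
  rw [phi11_eq_tsum, ← tsum_mul_left, tsum_congr hterm, ← hsum.tsum_comm]
  refine tsum_congr fun m => ?_
  rw [phi11_eq_tsum, ← tsum_mul_left]
  refine tsum_congr fun n => ?_
  have e : phiTerm 0 0 q (z * q ^ m) n = phiTerm 0 0 q z n * (q ^ n) ^ m := by
    simp only [phiTerm, mul_pow]; ring
  rw [e]; ring

/-- Heine's transformation with $x=a$ and $c=b/a$, whence $a\ne0$. Every argument $q^kq^m$ stays on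
the lattice, where the inner function is uniformly bounded. -/
theorem exists_abs_phi11_zpow_le {a b q : ℝ} (hq : 0 < q) (hq1 : q < 1) (ha0 : a ≠ 0)
    (ha : |a| < 1) (hb : |b| < 1) : ∃ C : ℝ, ∀ k : ℤ, |phi11 a b q (q ^ k)| ≤ C := by
  have hb' : |b / a * a| < 1 := by rwa [div_mul_cancel₀ _ ha0]
  have hg := summable_binTerm hq hq1 ha (b / a)
  refine ⟨(∑' m, |binTerm (b / a) q a m| * ∑' n, |phiTerm 0 0 q 1 n|) / |qBin (b / a) q a|,
    fun k => ?_⟩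
  rw [le_div_iff₀ (abs_pos.2 (qBin_ne_zero hq hq1 ha hb')), mul_comm, ← abs_mul]
  have h := qBin_mul_phi11 hq hq1 ha hb' (q ^ k)
  rw [div_mul_cancel₀ _ ha0] at h
  rw [h, ← Real.norm_eq_abs]
  refine tsum_of_norm_bounded (hg.abs.mul_right _).hasSum fun m => ?_
  rw [norm_mul, Real.norm_eq_abs, Real.norm_eq_abs, ← zpow_natCast q m, ← zpow_add₀ hq.ne']
  exact mul_le_mul_of_nonneg_left (abs_phi11_zero_zero_zpow_le hq hq1 _) (abs_nonneg _)

/-- The coefficient $b-za$ in `phi11_lower_both` is linear in the argument, so each step costs one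
power of $1+q^k$. -/
theorem phi11_growth_step {a b q z : ℝ} (hq : 0 < q) (hq1 : q < 1) (hb : |b| < 1)
    (h : ∃ (C : ℝ) (N : ℕ), ∀ k : ℤ,
      |phi11 (a * q) (b * q) q (z * q ^ k)| ≤ C * (1 + q ^ k) ^ N) :
    ∃ (C : ℝ) (N : ℕ), ∀ k : ℤ, |phi11 a b q (z * q ^ k)| ≤ C * (1 + q ^ k) ^ N := by
  obtain ⟨C, N, h⟩ := h
  have h3 : 1 - b ≠ 0 := by simpa using one_sub_mul_pow_ne_zero hq hq1 hb 0
  have hC : 0 ≤ C := by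
    have := (abs_nonneg _).trans (h 0)
    exact nonneg_of_mul_nonneg_left this (by positivity)
  refine ⟨C * (1 + |b| + |z * a|) / |1 - b|, N + 1, fun k => ?_⟩
  rw [div_mul_eq_mul_div, le_div_iff₀ (abs_pos.2 h3), mul_comm, ← abs_mul,
    ← phi11_lower_both hq hq1 hb]
  have hk : 0 < q ^ k := zpow_pos hq k
  have e : q * (z * q ^ k) = z * q ^ (k + 1) := by rw [zpow_add_one₀ hq.ne']; ring
  have hle : q ^ (k + 1) ≤ q ^ k := by
    rw [zpow_add_one₀ hq.ne']; exact mul_le_of_le_one_right hk.le hq1.le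
  have h1 := h k
  have h2 : |phi11 (a * q) (b * q) q (z * q ^ (k + 1))| ≤ C * (1 + q ^ k) ^ N :=
    (h (k + 1)).trans (mul_le_mul_of_nonneg_left
      (pow_le_pow_left₀ (by positivity) (by linarith) N) hC)
  have h4 : |b - z * q ^ k * a| ≤ |b| + |z * a| * q ^ k := by
    refine (abs_sub _ _).trans (le_of_eq ?_)
    rw [mul_right_comm, abs_mul (z * a), abs_of_pos hk]
  rw [e]
  set X := C * (1 + q ^ k) ^ N with hX
  have hX0 : 0 ≤ X := by positivity
  calc _ ≤ _ := abs_sub _ _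
    _ ≤ X + (|b| + |z * a| * q ^ k) * X := by
        rw [abs_mul]; exact add_le_add h1 (mul_le_mul h4 h2 (abs_nonneg _) (by positivity))
    _ = X * (1 + |b| + |z * a| * q ^ k) := by ring
    _ ≤ X * ((1 + |b| + |z * a|) * (1 + q ^ k)) := by
        refine mul_le_mul_of_nonneg_left ?_ hX0
        nlinarith [abs_nonneg b, abs_nonneg (z * a), mul_nonneg (abs_nonneg b) hk.le]
    _ = _ := by rw [hX, pow_succ]; ring

theorem phi11_growth_descend {q z : ℝ} (hq : 0 < q) (hq1 : q < 1) (j : ℕ) :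
    ∀ {a b : ℝ}, |b| < 1 → (∃ (C : ℝ) (N : ℕ), ∀ k : ℤ,
      |phi11 (a * q ^ j) (b * q ^ j) q (z * q ^ k)| ≤ C * (1 + q ^ k) ^ N) →
    ∃ (C : ℝ) (N : ℕ), ∀ k : ℤ, |phi11 a b q (z * q ^ k)| ≤ C * (1 + q ^ k) ^ N := by
  induction j with
  | zero => intro a b _ h; simpa using h
  | succ j ih =>
    intro a b hb h
    refine phi11_growth_step hq hq1 hb (ih (abs_mul_lt_one hq hq1 hb) ?_)
    simpa only [pow_succ', ← mul_assoc] using h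

theorem phi11_growth {a b q : ℝ} (hq : 0 < q) (hq1 : q < 1) (ha : a ≠ 0) (hb : |b| < 1) :
    ∃ (C : ℝ) (N : ℕ), ∀ k : ℤ, |phi11 a b q (q ^ k)| ≤ C * (1 + q ^ k) ^ N := by
  have h := (tendsto_pow_zero hq hq1).const_mul |a|
  rw [mul_zero] at h
  -- Enough raising steps bring $aq^j$ into the unit disc, where the bounded case applies.
  obtain ⟨j, hj⟩ := (h.eventually (gt_mem_nhds one_pos)).exists
  have hj' : |a * q ^ j| < 1 := by rwa [abs_mul, abs_of_pos (pow_pos hq j)]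
  obtain ⟨C, hC⟩ := exists_abs_phi11_zpow_le hq hq1 (mul_ne_zero ha (pow_ne_zero j hq.ne')) hj'
    (abs_mul_pow_lt_one hq hq1 hb j)
  simpa using phi11_growth_descend (z := 1) hq hq1 j hb ⟨C, 0, by simpa using hC⟩

theorem phi11_one (b q z : ℝ) : phi11 1 b q z = 1 := by
  rw [phi11_eq_tsum, tsum_eq_single 0, phiTerm_zero]
  intro n hn
  obtain ⟨m, rfl⟩ := Nat.exists_eq_succ_of_ne_zero hn
  simp [phiTerm, qPoch_succ']

/-- Raising both parameters $p$ times turns $q^{-p}$ into $1$, where the series is constant; hence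
no lattice condition on $z$ is needed. -/
theorem phi11_growth_terminating {b q : ℝ} (hq : 0 < q) (hq1 : q < 1) (hb : |b| < 1) (p : ℕ)
    (z : ℝ) : ∃ (C : ℝ) (N : ℕ), ∀ k : ℤ,
      |phi11 ((q ^ p)⁻¹) b q (z * q ^ k)| ≤ C * (1 + q ^ k) ^ N := by
  refine phi11_growth_descend hq hq1 p hb ⟨1, 0, fun k => ?_⟩
  rw [inv_mul_cancel₀ (pow_ne_zero p hq.ne'), phi11_one]
  simp

/-! ### The functions `V_k(x;s)` -/

/-- The weight `(-q^{2-2k}; q²)_∞`. -/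
def wt (q : ℝ) (k : ℤ) : ℝ := qPochInf (-q ^ (2 - 2 * k)) (q ^ 2)

theorem qPochInf_eq_mul {a q : ℝ} (hq : 0 < q) (hq1 : q < 1) :
    qPochInf a q = (1 - a) * qPochInf (a * q) q := by
  have hm : Multipliable fun i : ℕ => 1 - a * q ^ (i + 1) := by
    have hs : Summable fun i : ℕ => -(a * q) * q ^ i :=
      (summable_geometric_of_lt_one hq.le hq1).mul_left _
    refine (Real.multipliable_one_add_of_summable hs).congr fun i => ?_
    ring
  have h := tprod_eq_zero_mul' (f := fun i : ℕ => 1 - a * q ^ i) hm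
  simp only [pow_zero, mul_one] at h
  refine h.trans (congrArg _ (tprod_congr fun i => ?_))
  ring

/-- All finite partial products are at least $1$, and so is their limit. -/
theorem qPochInf_neg_pos {a q : ℝ} (ha : 0 ≤ a) (hq : 0 < q) (hq1 : q < 1) :
    0 < qPochInf (-a) q := by
  have hm : Multipliable fun i : ℕ => 1 - -a * q ^ i := by
    have hs : Summable fun i : ℕ => a * q ^ i :=
      (summable_geometric_of_lt_one hq.le hq1).mul_left _
    refine (Real.multipliable_one_add_of_summable hs).congr fun i => ?_
    ring
  refine one_pos.trans_le (ge_of_tendsto' hm.hasProd fun s => ?_)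
  have h1 : ∀ i ∈ s, (1 : ℝ) ≤ 1 - -a * q ^ i := fun i _ => by
    have : 0 ≤ a * q ^ i := by positivity
    linarith
  simpa using Finset.prod_le_prod (fun i _ => zero_le_one) h1

theorem wt_pos {q : ℝ} (hq : 0 < q) (hq1 : q < 1) (k : ℤ) : 0 < wt q k :=
  qPochInf_neg_pos (zpow_nonneg hq.le _) (by positivity) (pow_lt_one₀ hq.le hq1 two_ne_zero)

/-- Passing to $k+1$ adds one leading factor to the product, which is the square of the coefficient
of $\alpha$ on $e_k$. -/
theorem wt_add_one {q : ℝ} (hq : 0 < q) (hq1 : q < 1) (k : ℤ) :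
    wt q (k + 1) = (1 + q ^ (-2 * k)) * wt q k := by
  rw [wt, qPochInf_eq_mul (by positivity) (pow_lt_one₀ hq.le hq1 two_ne_zero), wt,
    neg_mul, ← zpow_natCast q 2, ← zpow_add₀ hq.ne', sub_neg_eq_add]
  congr 3
  · ring
  · push_cast; ring_nf

theorem sqrt_wt_add_one {q : ℝ} (hq : 0 < q) (hq1 : q < 1) (k : ℤ) :
    √(wt q (k + 1)) = √(1 + q ^ (-2 * k)) * √(wt q k) := by
  rw [wt_add_one hq hq1, Real.sqrt_mul (by positivity)]

/-- `q^{k(k+1)/2}`. -/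
def gauss (q : ℝ) (k : ℤ) : ℝ := q ^ ((1 / 2 : ℝ) * k * (k + 1))

theorem gauss_add_one {q : ℝ} (hq : 0 < q) (k : ℤ) :
    gauss q (k + 1) = gauss q k * q ^ (k + 1) := by
  rw [gauss, gauss, ← Real.rpow_intCast, ← Real.rpow_add hq]
  congr 1; push_cast; ring

theorem V_eq (q : ℝ) (k : ℤ) (x t : ℝ) : V q k x t = √(wt q k) * gauss q k * (-t) ^ (-k) *
    phi11 (-(x * t)⁻¹) (q ^ 2 * t ^ (-2 : ℤ)) (q ^ 2) (x * q ^ (2 * k + 2) * t⁻¹) := rfl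

theorem zpow_two_mul_add_two {q : ℝ} (hq : 0 < q) (k : ℤ) :
    q ^ (2 * k + 2) = q ^ 2 * (q ^ k) ^ 2 := by
  rw [zpow_add₀ hq.ne', mul_comm 2 k, zpow_mul]; norm_cast; ring

theorem zpow_neg_two_mul {q : ℝ} (k : ℤ) : q ^ (-2 * k) = ((q ^ k) ^ 2)⁻¹ := by
  rw [mul_comm, zpow_mul, zpow_neg]; norm_cast

/-- This is the role of $|t|>q$: no denominator $(q^2t^{-2};q^2)_n$ vanishes. -/
theorem abs_bottom_lt_one {q t : ℝ} (hq : 0 < q) (ht : q < |t|) : |q ^ 2 * t ^ (-2 : ℤ)| < 1 := by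
  have h0 : 0 < |t| := hq.trans ht
  have e : q ^ 2 * t ^ (-2 : ℤ) = (q / |t|) ^ 2 := by
    rw [div_pow, sq_abs, zpow_neg, div_eq_mul_inv]; norm_cast
  rw [e, abs_of_nonneg (by positivity)]
  exact pow_lt_one₀ (by positivity) ((div_lt_one h0).2 ht) two_ne_zero

/-! ### The contiguous relations as recurrences for $V_k$. -/

theorem V_action_alpha {q t x : ℝ} (hq : 0 < q) (hq1 : q < 1) (hx : x ≠ 0)
    (ht : q < |t|) (k : ℤ) :
    √(1 + q ^ (-2 * k)) * V q k x t + t * q ^ (-(k + 1)) * V q (k + 1) x t =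
      t⁻¹ * ((1 + x * t) / (1 - q ^ 2 * t ^ (-2 : ℤ))) * V q (k + 1) (x * q⁻¹) (t * q⁻¹) := by
  have ht0 : t ≠ 0 := abs_pos.1 (hq.trans ht)
  have hQ : 0 < q ^ 2 := by positivity
  have hQ1 : q ^ 2 < 1 := pow_lt_one₀ hq.le hq1 two_ne_zero
  have hb := abs_bottom_lt_one hq ht
  have hb1 : 1 - q ^ 2 * t ^ (-2 : ℤ) ≠ 0 := by
    simpa using one_sub_mul_pow_ne_zero hQ hQ1 hb 0
  have h := phi11_sub_phi11_mul (a := -(x * t)⁻¹) (z := x * q ^ (2 * k + 2) * t⁻¹) hQ hQ1 hb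
  have e1 : -(x * q⁻¹ * (t * q⁻¹))⁻¹ = -(x * t)⁻¹ * q ^ 2 := by field_simp
  have e2 : q ^ 2 * (t * q⁻¹) ^ (-2 : ℤ) = q ^ 2 * t ^ (-2 : ℤ) * q ^ 2 := by
    rw [mul_zpow, inv_zpow, zpow_neg, zpow_neg, inv_inv]; norm_cast; ring
  have e3 : x * q⁻¹ * q ^ (2 * (k + 1) + 2) * (t * q⁻¹)⁻¹ =
      q ^ 2 * (x * q ^ (2 * k + 2) * t⁻¹) := by
    rw [mul_add, add_assoc, zpow_add₀ hq.ne', zpow_add₀ hq.ne' (2 * k)]; field_simp; norm_cast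
  have e4 : x * q ^ (2 * (k + 1) + 2) * t⁻¹ = q ^ 2 * (x * q ^ (2 * k + 2) * t⁻¹) := by
    rw [mul_add, add_assoc, zpow_add₀ hq.ne', zpow_add₀ hq.ne' (2 * k)]; field_simp; norm_cast
  have e5 : (-(t * q⁻¹)) ^ (-(k + 1)) = (-t) ^ (-(k + 1)) * q ^ (k + 1) := by
    rw [← neg_mul, mul_zpow, inv_zpow', neg_neg]
  have e6 : (-t) ^ (-k) = (-t) ^ (-(k + 1)) * (-t) := by
    rw [← zpow_add_one₀ (neg_ne_zero.2 ht0)]; congr 1; ring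
  have hy : q ^ (k + 1) ≠ 0 := (zpow_pos hq _).ne'
  have e7 : q ^ (2 * k + 2) = (q ^ (k + 1)) ^ 2 := by
    rw [← zpow_natCast, ← zpow_mul]; congr 1; push_cast; ring
  rw [V_eq, V_eq, V_eq, e1, e2, e3, e4, e5, e6, sqrt_wt_add_one hq hq1, gauss_add_one hq,
    zpow_neg q]
  rw [e7] at h ⊢
  generalize q ^ (k + 1) = y at *
  generalize q ^ 2 * t ^ (-2 : ℤ) = b at *
  generalize phi11 (-(x * t)⁻¹) b (q ^ 2) (q ^ 2 * (x * y ^ 2 * t⁻¹)) = F1 at *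
  generalize phi11 (-(x * t)⁻¹) b (q ^ 2) (x * y ^ 2 * t⁻¹) = F0 at *
  generalize phi11 _ _ _ _ = F2 at *
  have h' : F0 - F1 = -(x * y ^ 2 * t⁻¹) * (1 - -(x * t)⁻¹) * F2 / (1 - b) := by
    rw [← h]; field_simp
  have h'' : F0 = F1 - (x * y ^ 2 * t⁻¹) * (1 + (x * t)⁻¹) * F2 / (1 - b) := by
    rw [sub_eq_iff_eq_add] at h'; rw [h']; ring
  rw [h'']
  field_simp
  ring

theorem V_action_beta {q t x : ℝ} (hq : 0 < q) (hq1 : q < 1) (hx : x ≠ 0)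
    (ht : 1 < |t|) (k : ℤ) :
    t * √(1 + q ^ (-2 * k)) * V q k x t + q ^ (-(k + 1)) * V q (k + 1) x t =
      -t ^ 2 * (1 - t ^ (-2 : ℤ)) * V q (k + 1) (x * q⁻¹) (t * q) := by
  have ht0 : t ≠ 0 := abs_pos.1 (one_pos.trans ht)
  have hQ : 0 < q ^ 2 := by positivity
  have hQ1 : q ^ 2 < 1 := pow_lt_one₀ hq.le hq1 two_ne_zero
  have hb : |t ^ (-2 : ℤ)| < 1 := by simpa using abs_bottom_lt_one one_pos ht
  have h := phi11_lower (a := -(x * t)⁻¹) (z := x * q ^ (2 * k + 2) * t⁻¹) hQ hQ1 hb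
  rw [mul_comm (t ^ (-2 : ℤ)) (q ^ 2)] at h
  have e1 : -(x * q⁻¹ * (t * q))⁻¹ = -(x * t)⁻¹ := by field_simp
  have e2 : q ^ 2 * (t * q) ^ (-2 : ℤ) = t ^ (-2 : ℤ) := by
    rw [mul_zpow, zpow_neg q]; norm_cast; field_simp
  have e3 : x * q⁻¹ * q ^ (2 * (k + 1) + 2) * (t * q)⁻¹ = x * q ^ (2 * k + 2) * t⁻¹ := by
    rw [mul_add, add_assoc, zpow_add₀ hq.ne', zpow_add₀ hq.ne' (2 * k)]; field_simp; norm_cast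
  have e4 : x * q ^ (2 * (k + 1) + 2) * t⁻¹ = q ^ 2 * (x * q ^ (2 * k + 2) * t⁻¹) := by
    rw [mul_add, add_assoc, zpow_add₀ hq.ne', zpow_add₀ hq.ne' (2 * k)]; field_simp; norm_cast
  have e5 : (-(t * q)) ^ (-(k + 1)) = (-t) ^ (-(k + 1)) * (q ^ (k + 1))⁻¹ := by
    rw [← neg_mul, mul_zpow, zpow_neg q]
  have e6 : (-t) ^ (-k) = (-t) ^ (-(k + 1)) * (-t) := by
    rw [← zpow_add_one₀ (neg_ne_zero.2 ht0)]; congr 1; ring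
  have hy : q ^ (k + 1) ≠ 0 := (zpow_pos hq _).ne'
  have e8 : t ^ (-2 : ℤ) = (t ^ 2)⁻¹ := by rw [zpow_neg]; norm_cast
  rw [V_eq, V_eq, V_eq, e1, e2, e3, e4, e5, e6, sqrt_wt_add_one hq hq1, gauss_add_one hq,
    zpow_neg q]
  generalize phi11 _ _ _ (q ^ 2 * _) = F1 at *
  generalize phi11 _ (q ^ 2 * _) _ _ = F0 at *
  generalize phi11 _ _ _ _ = F2 at *
  rw [e8] at h ⊢
  have h' : F0 = (1 - (t ^ 2)⁻¹) * F2 + (t ^ 2)⁻¹ * F1 := by rw [← h]; ring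
  rw [h']
  field_simp
  ring

theorem V_action_gamma {q t x : ℝ} (hq : 0 < q) (hq1 : q < 1) (hx : x ≠ 0)
    (ht : q < |t|) (k : ℤ) :
    q ^ (-k) * V q k x t + q⁻¹ * t * √(1 + q ^ (-2 * k)) * V q (k + 1) x t =
      -((1 + q ^ 2 * x * t⁻¹) / (1 - q ^ 2 * t ^ (-2 : ℤ))) * V q k (x * q) (t * q⁻¹) := by
  have ht0 : t ≠ 0 := abs_pos.1 (hq.trans ht)
  have hQ : 0 < q ^ 2 := by positivity
  have hQ1 : q ^ 2 < 1 := pow_lt_one₀ hq.le hq1 two_ne_zero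
  have hb := abs_bottom_lt_one hq ht
  have hb1 : 1 - q ^ 2 * t ^ (-2 : ℤ) ≠ 0 := by
    simpa using one_sub_mul_pow_ne_zero hQ hQ1 hb 0
  have h := phi11_raise (a := -(x * t)⁻¹) (z := x * q ^ (2 * k + 2) * t⁻¹) hQ hQ1 hb
  have e1 : -(x * q * (t * q⁻¹))⁻¹ = -(x * t)⁻¹ := by field_simp
  have e2 : q ^ 2 * (t * q⁻¹) ^ (-2 : ℤ) = q ^ 2 * t ^ (-2 : ℤ) * q ^ 2 := by
    rw [mul_zpow, inv_zpow, zpow_neg, zpow_neg, inv_inv]; norm_cast; ring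
  have e3 : x * q * q ^ (2 * k + 2) * (t * q⁻¹)⁻¹ = q ^ 2 * (x * q ^ (2 * k + 2) * t⁻¹) := by
    field_simp
  have e4 : x * q ^ (2 * (k + 1) + 2) * t⁻¹ = q ^ 2 * (x * q ^ (2 * k + 2) * t⁻¹) := by
    rw [mul_add, add_assoc, zpow_add₀ hq.ne', zpow_add₀ hq.ne' (2 * k)]; field_simp; norm_cast
  have e5 : (-(t * q⁻¹)) ^ (-k) = (-t) ^ (-k) * q ^ k := by
    rw [← neg_mul, mul_zpow, inv_zpow', neg_neg]
  have e6 : (-t) ^ (-k) = (-t) ^ (-(k + 1)) * (-t) := by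
    rw [← zpow_add_one₀ (neg_ne_zero.2 ht0)]; congr 1; ring
  have hy : q ^ k ≠ 0 := (zpow_pos hq _).ne'
  have e8 : t ^ (-2 : ℤ) = (t ^ 2)⁻¹ := by rw [zpow_neg]; norm_cast
  -- The root occurs both in the operator and in the weight of $V_{k+1}$, so only its square
  -- survives.
  have hsq : √(1 + q ^ (-2 * k)) ^ 2 = 1 + ((q ^ k) ^ 2)⁻¹ := by
    rw [Real.sq_sqrt (by positivity), zpow_neg_two_mul]
  rw [V_eq, V_eq, V_eq, e1, e2, e3, e4, e5, e6, sqrt_wt_add_one hq hq1, gauss_add_one hq,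
    zpow_add_one₀ hq.ne', zpow_neg q]
  generalize phi11 _ (q ^ 2 * t ^ (-2 : ℤ)) _ (q ^ 2 * _) = F1 at *
  generalize phi11 _ (q ^ 2 * t ^ (-2 : ℤ)) _ _ = F0 at *
  generalize phi11 _ _ _ _ = F2 at *
  rw [zpow_two_mul_add_two hq] at h
  rw [e8] at h hb1 ⊢
  generalize q ^ k = y at *
  generalize √(1 + q ^ (-2 * k)) = u at *
  generalize (-t) ^ (-(k + 1)) = T at *
  generalize hbb : q ^ 2 * (t ^ 2)⁻¹ = b at *
  have hb0 : b ≠ 0 := by rw [← hbb]; positivity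
  have h' : F0 = (1 + y ^ 2) * F1 -
      y ^ 2 * ((1 + q ^ 2 * x * t⁻¹) / (1 - b)) * F2 := by
    refine mul_left_cancel₀ (mul_ne_zero hb0 hb1) ?_
    have e9 : b * (1 - b) * ((1 + y ^ 2) * F1 - y ^ 2 * ((1 + q ^ 2 * x * t⁻¹) / (1 - b)) * F2) =
      (1 - b) * (b * (1 + y ^ 2) * F1) - b * y ^ 2 * (1 + q ^ 2 * x * t⁻¹) * F2 := by
        field_simp
    -- Here $za=-bq^{2k}$, so the coefficient $b-za$ becomes $b(1+q^{2k})$ and matches the squared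
    -- root.
    have e10 : x * (q ^ 2 * y ^ 2) * t⁻¹ * -(x * t)⁻¹ = -(b * y ^ 2) := by
      rw [← hbb]; field_simp
    have e11 : x * (q ^ 2 * y ^ 2) * t⁻¹ * (b - -(x * t)⁻¹) =
        b * y ^ 2 * (1 + q ^ 2 * x * t⁻¹) := by
      rw [← hbb]; field_simp; ring
    rw [e10, e11] at h
    rw [e9]
    linear_combination -h
  have e12 : q⁻¹ * t * u * (u * √(wt q k) * (gauss q k * (y * q)) * T * F1) =
      u ^ 2 * y * t * √(wt q k) * gauss q k * T * F1 := by field_simp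
  rw [e12, hsq, h']
  generalize (1 + q ^ 2 * x * t⁻¹) / (1 - b) = r
  field_simp
  ring

theorem V_action_delta {q t x : ℝ} (hq : 0 < q) (hq1 : q < 1) (hx : x ≠ 0)
    (ht : 1 < |t|) (k : ℤ) :
    t * q ^ (-k) * V q k x t + q⁻¹ * √(1 + q ^ (-2 * k)) * V q (k + 1) x t =
      t * (1 - t ^ (-2 : ℤ)) * V q k (x * q) (t * q) := by
  have ht0 : t ≠ 0 := abs_pos.1 (one_pos.trans ht)
  have hQ : 0 < q ^ 2 := by positivity
  have hQ1 : q ^ 2 < 1 := pow_lt_one₀ hq.le hq1 two_ne_zero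
  have hb : |t ^ (-2 : ℤ)| < 1 := by simpa using abs_bottom_lt_one one_pos ht
  have h := phi11_lower_both (a := -(x * q * (t * q))⁻¹) (z := x * q ^ (2 * k + 2) * t⁻¹) hQ hQ1 hb
  have e1 : -(x * q * (t * q))⁻¹ * q ^ 2 = -(x * t)⁻¹ := by field_simp
  rw [mul_comm (t ^ (-2 : ℤ)) (q ^ 2), e1] at h
  have e2 : q ^ 2 * (t * q) ^ (-2 : ℤ) = t ^ (-2 : ℤ) := by
    rw [mul_zpow, zpow_neg q]; norm_cast; field_simp
  have e3 : x * q * q ^ (2 * k + 2) * (t * q)⁻¹ = x * q ^ (2 * k + 2) * t⁻¹ := by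
    field_simp
  have e4 : x * q ^ (2 * (k + 1) + 2) * t⁻¹ = q ^ 2 * (x * q ^ (2 * k + 2) * t⁻¹) := by
    rw [mul_add, add_assoc, zpow_add₀ hq.ne', zpow_add₀ hq.ne' (2 * k)]; field_simp; norm_cast
  have e5 : (-(t * q)) ^ (-k) = (-t) ^ (-k) * (q ^ k)⁻¹ := by
    rw [← neg_mul, mul_zpow, zpow_neg q]
  have e6 : (-t) ^ (-k) = (-t) ^ (-(k + 1)) * (-t) := by
    rw [← zpow_add_one₀ (neg_ne_zero.2 ht0)]; congr 1; ring
  have hy : q ^ k ≠ 0 := (zpow_pos hq _).ne'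
  have e8 : t ^ (-2 : ℤ) = (t ^ 2)⁻¹ := by rw [zpow_neg]; norm_cast
  have hsq : √(1 + q ^ (-2 * k)) ^ 2 = 1 + ((q ^ k) ^ 2)⁻¹ := by
    rw [Real.sq_sqrt (by positivity), zpow_neg_two_mul]
  rw [V_eq, V_eq, V_eq, e2, e3, e4, e5, e6, sqrt_wt_add_one hq hq1, gauss_add_one hq,
    zpow_add_one₀ hq.ne', zpow_neg q]
  generalize phi11 _ _ _ (q ^ 2 * _) = F1 at *
  generalize phi11 _ (q ^ 2 * _) _ _ = F0 at *
  generalize phi11 _ _ _ _ = F2 at *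
  rw [zpow_two_mul_add_two hq] at h
  rw [e8] at h ⊢
  generalize q ^ k = y at *
  generalize √(1 + q ^ (-2 * k)) = u at *
  generalize (-t) ^ (-(k + 1)) = T at *
  have e10 : x * (q ^ 2 * y ^ 2) * t⁻¹ * -(x * q * (t * q))⁻¹ = -((t ^ 2)⁻¹ * y ^ 2) := by
    field_simp
  rw [e10] at h
  have h' : F0 = (1 - (t ^ 2)⁻¹) * F2 + (t ^ 2)⁻¹ * (1 + y ^ 2) * F1 := by
    rw [← h]; ring
  have e12 : q⁻¹ * u * (u * √(wt q k) * (gauss q k * (y * q)) * T * F1) =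
      u ^ 2 * y * √(wt q k) * gauss q k * T * F1 := by field_simp
  rw [e12, hsq, h']
  field_simp
  ring

/-! ### Square summability -/

theorem wt_term_add_one {q r : ℝ} (hq : 0 < q) (hq1 : q < 1) (hr : 0 < r) (M : ℕ) (k : ℤ) :
    wt q (k + 1) * gauss q (k + 1) ^ 2 * r ^ (k + 1) * (1 + (q ^ 2) ^ (k + 1)) ^ M =
      wt q k * gauss q k ^ 2 * r ^ k * (1 + (q ^ 2) ^ k) ^ M *
        ((1 + (q ^ 2) ^ k) * (q ^ 2 * r) * ((1 + q ^ 2 * (q ^ 2) ^ k) / (1 + (q ^ 2) ^ k)) ^ M) := by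
  have hQ : 0 < q ^ 2 := by positivity
  have e : q ^ (-2 * k) = ((q ^ 2) ^ k)⁻¹ := by
    rw [zpow_mul, zpow_neg, inv_zpow]; norm_cast
  have e2 : (q ^ k) ^ 2 = (q ^ 2) ^ k := by
    rw [← zpow_natCast, ← zpow_mul, ← zpow_natCast q, ← zpow_mul, mul_comm]
  have hy : 0 < (q ^ 2) ^ k := zpow_pos hQ k
  rw [wt_add_one hq hq1, gauss_add_one hq, zpow_add_one₀ hq.ne', zpow_add_one₀ hr.ne',
    zpow_add_one₀ hQ.ne', e, mul_pow, mul_pow, e2]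
  generalize (q ^ 2) ^ k = y at *
  have h1 : (1 + y) ^ M ≠ 0 := by positivity
  rw [div_pow, mul_comm y (q ^ 2)]
  field_simp
  ring

/-- Ratio test in both directions. The ratio of consecutive terms tends to $q^2r$ as $k\to\infty$;
stepping towards $-\infty$ it tends to $0$ because of the factor $1+q^{2k}$, whatever the power $M$.
-/
theorem summable_wt_term {q r : ℝ} (hq : 0 < q) (hq1 : q < 1) (hr : 0 < r) (hr1 : q ^ 2 * r < 1)
    (M : ℕ) : Summable fun k : ℤ =>
      wt q k * gauss q k ^ 2 * r ^ k * (1 + (q ^ 2) ^ k) ^ M := by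
  have hQ : 0 < q ^ 2 := by positivity
  have hQ1 : q ^ 2 < 1 := pow_lt_one₀ hq.le hq1 two_ne_zero
  have hlim := tendsto_pow_zero hQ hQ1
  have hrec := wt_term_add_one hq hq1 hr M
  set T : ℤ → ℝ := fun k => wt q k * gauss q k ^ 2 * r ^ k * (1 + (q ^ 2) ^ k) ^ M with hT
  refine Summable.of_nat_of_neg ?_ ?_
  · refine summable_of_ratio_tendsto (f := fun n : ℕ => T n) (g := fun n => (1 + (q ^ 2) ^ n) *
      (q ^ 2 * r) * ((1 + q ^ 2 * (q ^ 2) ^ n) / (1 + (q ^ 2) ^ n)) ^ M) (l := q ^ 2 * r) ?_ ?_ ?_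
    · intro n
      have := hrec n
      simp only [zpow_natCast] at this
      exact_mod_cast this
    · have h1 : Tendsto (fun n : ℕ => 1 + (q ^ 2) ^ n) atTop (𝓝 1) := by
        simpa using hlim.const_add 1
      have h2 : Tendsto (fun n : ℕ => 1 + q ^ 2 * (q ^ 2) ^ n) atTop (𝓝 1) := by
        simpa using (hlim.const_mul (q ^ 2)).const_add 1
      have h := (h1.mul_const (q ^ 2 * r)).mul ((h2.div h1 one_ne_zero).pow M)
      simpa only [one_mul, div_one, one_pow, mul_one, Pi.div_apply] using h
    · rwa [abs_of_pos (by positivity)]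
  · refine summable_of_ratio_tendsto (f := fun n : ℕ => T (-(n : ℤ)))
      (g := fun n => (q ^ 2) ^ (n + 1) / (1 + (q ^ 2) ^ (n + 1)) / (q ^ 2 * r) *
        ((1 + (q ^ 2) ^ (n + 1)) / (q ^ 2 + (q ^ 2) ^ (n + 1))) ^ M) (l := 0) ?_ ?_ ?_
    · intro n
      have h := hrec (-((n + 1 : ℕ) : ℤ))
      have e : -((n + 1 : ℕ) : ℤ) + 1 = -(n : ℤ) := by push_cast; ring
      rw [e] at h
      change T (-((n + 1 : ℕ) : ℤ)) = T (-(n : ℤ)) * _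
      change T (-(n : ℤ)) = T (-((n + 1 : ℕ) : ℤ)) * _ at h
      rw [h, zpow_neg, zpow_natCast]
      have hy : 0 < (q ^ 2) ^ (n + 1) := by positivity
      generalize (q ^ 2) ^ (n + 1) = y at *
      have e1 : (1 + q ^ 2 * y⁻¹) / (1 + y⁻¹) = (q ^ 2 + y) / (1 + y) := by
        field_simp; ring
      have e2 : ((q ^ 2 + y) / (1 + y)) ^ M * ((1 + y) / (q ^ 2 + y)) ^ M = 1 := by
        rw [← mul_pow, div_mul_div_comm, mul_comm, div_self (by positivity), one_pow]
      have e3 : (1 + y⁻¹) * (q ^ 2 * r) * (y / (1 + y) / (q ^ 2 * r)) = 1 := by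
        field_simp; ring
      rw [e1]
      linear_combination (-T (-((n + 1 : ℕ) : ℤ)) * ((q ^ 2 + y) / (1 + y)) ^ M *
        ((1 + y) / (q ^ 2 + y)) ^ M) * e3 - T (-((n + 1 : ℕ) : ℤ)) * e2
    · have hl := (tendsto_add_atTop_iff_nat 1).2 hlim
      have h1 : Tendsto (fun n : ℕ => 1 + (q ^ 2) ^ (n + 1)) atTop (𝓝 1) := by
        simpa using hl.const_add 1
      have h2 : Tendsto (fun n : ℕ => q ^ 2 + (q ^ 2) ^ (n + 1)) atTop (𝓝 (q ^ 2)) := by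
        simpa using hl.const_add (q ^ 2)
      have h := ((hl.div h1 one_ne_zero).div_const (q ^ 2 * r)).mul ((h1.div h2 hQ.ne').pow M)
      simpa only [zero_div, zero_mul, Pi.div_apply] using h
    · simp

/-- The free parameter $\rho$ serves two purposes: $\rho=1$ gives membership in $\ell^2$ for
$|s|>q$, and $\rho=q^{-2}$ gives membership in $\mathcal D(Q)$ for $|s|>1$. -/
theorem summable_sq_V_mul_zpow {q s x ρ : ℝ} (hq : 0 < q) (hq1 : q < 1) (hs : s ≠ 0) (hρ : 0 < ρ)
    (hρ1 : q ^ 2 * ρ < s ^ 2)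
    (h : ∃ (C : ℝ) (N : ℕ), ∀ k : ℤ, |phi11 (-(x * s)⁻¹) (q ^ 2 * s ^ (-2 : ℤ)) (q ^ 2)
      (x * q ^ (2 * k + 2) * s⁻¹)| ≤ C * (1 + (q ^ 2) ^ k) ^ N) :
    Summable fun k : ℤ => V q k x s ^ 2 * ρ ^ k := by
  obtain ⟨C, N, h⟩ := h
  have hs2 : 0 < s ^ 2 := by positivity
  have hr1 : q ^ 2 * (ρ / s ^ 2) < 1 := by rwa [← mul_div_assoc, div_lt_one hs2]
  refine Summable.of_nonneg_of_le (fun k => by positivity) (fun k => ?_)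
    ((summable_wt_term hq hq1 (div_pos hρ hs2) hr1 (N * 2)).mul_left (C ^ 2))
  have e1 : ((-s) ^ (-k)) ^ 2 = (s ^ 2) ^ (-k) := by
    rw [← zpow_natCast, ← zpow_mul, mul_comm, zpow_mul]; simp
  have e2 : V q k x s ^ 2 * ρ ^ k = wt q k * gauss q k ^ 2 * (ρ / s ^ 2) ^ k *
      phi11 (-(x * s)⁻¹) (q ^ 2 * s ^ (-2 : ℤ)) (q ^ 2) (x * q ^ (2 * k + 2) * s⁻¹) ^ 2 := by
    rw [V_eq, mul_pow, mul_pow, mul_pow, Real.sq_sqrt (wt_pos hq hq1 k).le, e1, div_zpow, zpow_neg]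
    ring
  rw [e2]
  have h2 := pow_le_pow_left₀ (abs_nonneg _) (h k) 2
  rw [sq_abs, mul_pow, ← pow_mul] at h2
  have hp : 0 ≤ wt q k * gauss q k ^ 2 * (ρ / s ^ 2) ^ k := by
    have := wt_pos hq hq1 k
    positivity
  refine (mul_le_mul_of_nonneg_left h2 hp).trans (le_of_eq ?_)
  ring

/-! ### Growth at the parameters of $v_p$ and $w_p$, and membership in $\ell^2$ and $\mathcal D(Q)$.
-/

theorem growth_v {q s : ℝ} (hq : 0 < q) (hq1 : q < 1) (hs : q < |s|) (p : ℕ) :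
    ∃ (C : ℝ) (N : ℕ), ∀ k : ℤ, |phi11 (-((-q ^ (2 * (p : ℤ)) * s⁻¹) * s)⁻¹)
      (q ^ 2 * s ^ (-2 : ℤ)) (q ^ 2) (-q ^ (2 * (p : ℤ)) * s⁻¹ * q ^ (2 * k + 2) * s⁻¹)| ≤
        C * (1 + (q ^ 2) ^ k) ^ N := by
  have hs0 : s ≠ 0 := abs_pos.1 (hq.trans hs)
  obtain ⟨C, N, h⟩ := phi11_growth_terminating (by positivity : 0 < q ^ 2)
    (pow_lt_one₀ hq.le hq1 two_ne_zero) (abs_bottom_lt_one hq hs) p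
    (-q ^ (2 * (p : ℤ)) * s⁻¹ * q ^ 2 * s⁻¹)
  refine ⟨C, N, fun k => ?_⟩
  have e1 : -((-q ^ (2 * (p : ℤ)) * s⁻¹) * s)⁻¹ = ((q ^ 2) ^ p)⁻¹ := by
    rw [inv_mul_cancel_right₀ hs0, inv_neg, neg_neg, ← pow_mul]; norm_cast
  have e2 : q ^ (2 * k + 2) = q ^ 2 * (q ^ 2) ^ k := by
    rw [zpow_add₀ hq.ne', zpow_mul]; norm_cast; ring
  have := h k
  rw [e1, e2]
  convert this using 3
  ring

theorem growth_w {q s : ℝ} (hq : 0 < q) (hq1 : q < 1) (hs : q < |s|) (p : ℤ) :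
    ∃ (C : ℝ) (N : ℕ), ∀ k : ℤ, |phi11 (-((q ^ (2 * p) * s) * s)⁻¹)
      (q ^ 2 * s ^ (-2 : ℤ)) (q ^ 2) (q ^ (2 * p) * s * q ^ (2 * k + 2) * s⁻¹)| ≤
        C * (1 + (q ^ 2) ^ k) ^ N := by
  have hs0 : s ≠ 0 := abs_pos.1 (hq.trans hs)
  have hQ : 0 < q ^ 2 := by positivity
  have ha : -((q ^ (2 * p) * s) * s)⁻¹ ≠ 0 :=
    neg_ne_zero.2 (inv_ne_zero (mul_ne_zero (mul_ne_zero (zpow_ne_zero _ hq.ne') hs0) hs0))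
  obtain ⟨C, N, h⟩ := phi11_growth hQ
    (pow_lt_one₀ hq.le hq1 two_ne_zero) ha (abs_bottom_lt_one hq hs)
  have hC : 0 ≤ C := nonneg_of_mul_nonneg_left ((abs_nonneg _).trans (h 0)) (by positivity)
  -- The argument is $(q^2)^{k+p+1}$, and $1+uv\le(1+u)(1+v)$ absorbs the offset $p+1$ into the
  -- constant.
  refine ⟨C * (1 + (q ^ 2) ^ (p + 1)) ^ N, N, fun k => ?_⟩
  have e2 : q ^ (2 * p) * s * q ^ (2 * k + 2) * s⁻¹ = (q ^ 2) ^ (k + (p + 1)) := by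
    have : (q ^ 2) ^ (k + (p + 1)) = q ^ (2 * p) * q ^ (2 * k + 2) := by
      rw [← zpow_add₀ hq.ne', ← zpow_natCast, ← zpow_mul]; congr 1; push_cast; ring
    rw [this]; field_simp
  rw [e2, mul_assoc C, ← mul_pow]
  refine (h _).trans (mul_le_mul_of_nonneg_left (pow_le_pow_left₀ ?_ ?_ N) hC)
  · have := zpow_pos hQ (k + (p + 1)); linarith
  · rw [zpow_add₀ hQ.ne' k]
    have h1 := zpow_pos hQ k
    have h2 := zpow_pos hQ (p + 1)
    nlinarith

theorem norm_coeffs (q θ x t : ℝ) (k : ℤ) : ‖coeffs q θ x t k‖ = |V q k x t| := by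
  have e : Complex.I * k * θ = ((k * θ : ℝ) : ℂ) * Complex.I := by push_cast; ring
  rw [coeffs, norm_mul, e, Complex.norm_exp_ofReal_mul_I, one_mul, Complex.norm_real,
    Real.norm_eq_abs]

theorem memℓp_two_iff {c : ℤ → ℂ} : Memℓp c 2 ↔ Summable fun k => ‖c k‖ ^ 2 := by
  rw [memℓp_gen_iff (by simp)]
  simp

theorem ofCoeffs_apply {c : ℤ → ℂ} (h : Memℓp c 2) (k : ℤ) : ofCoeffs c k = c k := by
  rw [ofCoeffs, dif_pos h]

theorem mem_DQ {q : ℝ} {c : L2Z} : c ∈ DQ q ↔ Summable fun k : ℤ => ‖c k‖ ^ 2 * q ^ (-2 * k) :=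
  Iff.rfl

theorem memℓp_coeffs {q s x : ℝ} (θ : ℝ) (hq : 0 < q) (hq1 : q < 1) (hs : q < |s|)
    (h : ∃ (C : ℝ) (N : ℕ), ∀ k : ℤ, |phi11 (-(x * s)⁻¹) (q ^ 2 * s ^ (-2 : ℤ)) (q ^ 2)
      (x * q ^ (2 * k + 2) * s⁻¹)| ≤ C * (1 + (q ^ 2) ^ k) ^ N) :
    Memℓp (coeffs q θ x s) 2 := by
  rw [memℓp_two_iff]
  have h1 := summable_sq_V_mul_zpow hq hq1 (abs_pos.1 (hq.trans hs)) one_pos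
    (by rw [mul_one, ← sq_abs s]; exact pow_lt_pow_left₀ hs hq.le two_ne_zero) h
  refine h1.congr fun k => ?_
  rw [norm_coeffs, sq_abs, one_zpow, mul_one]

theorem ofCoeffs_mem_DQ {q t x : ℝ} (θ : ℝ) (hq : 0 < q) (hq1 : q < 1) (ht : 1 < |t|)
    (h : ∃ (C : ℝ) (N : ℕ), ∀ k : ℤ, |phi11 (-(x * t)⁻¹) (q ^ 2 * t ^ (-2 : ℤ)) (q ^ 2)
      (x * q ^ (2 * k + 2) * t⁻¹)| ≤ C * (1 + (q ^ 2) ^ k) ^ N) :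
    ofCoeffs (coeffs q θ x t) ∈ DQ q := by
  have hm := memℓp_coeffs θ hq hq1 (hq1.trans ht) h
  have hQ : 0 < q ^ 2 := by positivity
  have h1 := summable_sq_V_mul_zpow hq hq1 (abs_pos.1 (one_pos.trans ht)) (inv_pos.2 hQ)
    (by rw [mul_inv_cancel₀ hQ.ne', ← sq_abs t]; exact one_lt_pow₀ ht two_ne_zero) h
  refine mem_DQ.2 (h1.congr fun k => ?_)
  rw [ofCoeffs_apply hm, norm_coeffs, sq_abs, zpow_mul]
  congr 2

/-! ### Operators acting by two neighbouring weighted shifts -/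

theorem norm_sq_weight_le {K : ℝ} {q : ℝ} {A z : ℂ} {k : ℤ}
    (hA : ‖A‖ ^ 2 ≤ K * (1 + q ^ (-2 * k))) :
    ‖A * z‖ ^ 2 ≤ K * (‖z‖ ^ 2 + ‖z‖ ^ 2 * q ^ (-2 * k)) := by
  rw [norm_mul, mul_pow]
  nlinarith [mul_le_mul_of_nonneg_right hA (sq_nonneg ‖z‖)]

theorem memℓp_weight {q K : ℝ} {A : ℤ → ℂ} (hA : ∀ k, ‖A k‖ ^ 2 ≤ K * (1 + q ^ (-2 * k)))
    {c : L2Z} (hc : c ∈ DQ q) : Memℓp (fun k => A k * c k) 2 := by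
  rw [memℓp_two_iff]
  exact Summable.of_nonneg_of_le (fun k => by positivity) (fun k => norm_sq_weight_le (hA k))
    (((memℓp_two_iff.1 (lp.memℓp c)).add (mem_DQ.1 hc)).mul_left K)

theorem incl_single (k : ℤ) (z : ℂ) : incl (Finsupp.single k z) = lp.single 2 k z := by
  rw [incl, Finsupp.linearCombination_single, basisVec, ← lp.single_smul, smul_eq_mul, mul_one]

/-- Weights of size $O((1+q^{-2k})^{1/2})$ map $\mathcal D(Q)$ into $\ell^2$, so the series splits
into two orthogonal expansions, one of them reindexed by $d$. -/
theorem hasSum_two_shifts {q K : ℝ} {A B : ℤ → ℂ} (d : ℤ) {T : Module.End ℂ DZ}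
    (hT : ∀ k, T (Finsupp.single k 1) = Finsupp.single (k + d) (A k) + Finsupp.single k (B k))
    (hA : ∀ k, ‖A k‖ ^ 2 ≤ K * (1 + q ^ (-2 * k))) (hB : ∀ k, ‖B k‖ ^ 2 ≤ K * (1 + q ^ (-2 * k)))
    {c : L2Z} (hc : c ∈ DQ q) :
    ∃ y : L2Z, (∀ m, y m = A (m - d) * c (m - d) + B m * c m) ∧
      HasSum (fun k : ℤ => c k • incl (T (Finsupp.single k 1))) y := by
  have h1 := memℓp_weight hA hc
  have h2 := memℓp_weight hB hc
  have h1' : Memℓp (fun m : ℤ => A (m - d) * c (m - d)) 2 := by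
    rw [memℓp_two_iff] at h1 ⊢
    exact (Equiv.subRight d).summable_iff.2 h1
  let y1 : L2Z := ⟨_, h1'⟩
  let y2 : L2Z := ⟨_, h2⟩
  refine ⟨y1 + y2, fun m => rfl, ?_⟩
  have s1 := (Equiv.addRight d).hasSum_iff.2 (lp.hasSum_single (by simp) y1)
  have s2 := lp.hasSum_single (by simp) y2
  convert s1.add s2 using 2 with k
  rw [hT, map_add, incl_single, incl_single, smul_add, ← lp.single_smul, ← lp.single_smul]
  change _ = (lp.single 2 (k + d) (A (k + d - d) * c (k + d - d)) : L2Z) +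
    (lp.single 2 k (B k * c k) : L2Z)
  rw [add_sub_cancel_right, smul_eq_mul, smul_eq_mul, mul_comm (c k), mul_comm (c k)]

theorem extend_domain {q K : ℝ} {A B : ℤ → ℂ} (d : ℤ) {T : Module.End ℂ DZ}
    (hT : ∀ k, T (Finsupp.single k 1) = Finsupp.single (k + d) (A k) + Finsupp.single k (B k))
    (hA : ∀ k, ‖A k‖ ^ 2 ≤ K * (1 + q ^ (-2 * k))) (hB : ∀ k, ‖B k‖ ^ 2 ≤ K * (1 + q ^ (-2 * k))) :
    (extend q T).domain = DQ q := by
  ext c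
  refine ⟨fun h => h.1, fun h => ⟨h, ?_⟩⟩
  obtain ⟨y, -, hy⟩ := hasSum_two_shifts d hT hA hB h
  exact hy.summable

/-- Reduces an operator identity to one scalar identity per coordinate. The alternative $\mu=0$
covers $\alpha_{\infty,t}v_0=0$, where nothing need be known about the target sequence. -/
theorem mapsVec_ofCoeffs {q K : ℝ} {A B : ℤ → ℂ} (d : ℤ) {T : Module.End ℂ DZ}
    (hT : ∀ k, T (Finsupp.single k 1) = Finsupp.single (k + d) (A k) + Finsupp.single k (B k))
    (hA : ∀ k, ‖A k‖ ^ 2 ≤ K * (1 + q ^ (-2 * k))) (hB : ∀ k, ‖B k‖ ^ 2 ≤ K * (1 + q ^ (-2 * k)))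
    {c c' : ℤ → ℂ} {μ : ℂ} (hc : Memℓp c 2) (hcD : ofCoeffs c ∈ DQ q)
    (hc' : μ = 0 ∨ Memℓp c' 2) (h : ∀ m, A (m - d) * c (m - d) + B m * c m = μ * c' m) :
    MapsVec (extend q T) (ofCoeffs c) (μ • ofCoeffs c') := by
  obtain ⟨y, hy, hs⟩ := hasSum_two_shifts d hT hA hB hcD
  refine ⟨⟨hcD, hs.summable⟩, hs.tsum_eq.trans ?_⟩
  refine lp.ext (funext fun m => ?_)
  rw [hy, ofCoeffs_apply hc, ofCoeffs_apply hc, h]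
  change _ = μ * (ofCoeffs c' m)
  rcases hc' with rfl | hc'
  · rw [zero_mul, zero_mul]
  · rw [ofCoeffs_apply hc']

/-! ### The action of `α_{∞,t}`, `β_{∞,t}`, `γ_{∞,t}`, `δ_{∞,t}` -/

theorem conj_exp_I_mul (θ : ℝ) :
    (starRingEnd ℂ) (Complex.exp (Complex.I * θ)) = Complex.exp (-(Complex.I * θ)) := by
  rw [← Complex.exp_conj]; simp

theorem norm_exp_neg_I_mul (θ : ℝ) : ‖Complex.exp (-(Complex.I * θ))‖ = 1 := by
  rw [← conj_exp_I_mul, RCLike.norm_conj, Complex.norm_exp_I_mul_ofReal]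

theorem rep_ab_single {q : ℝ} (hq : 0 < q) (θ : ℝ) (u w : ℂ) (k : ℤ) :
    rep hq (Complex.exp (Complex.I * θ)) (u • gen q Gen.a + w • gen q Gen.b)
      (Finsupp.single k 1) =
    Finsupp.single (k + 1) (u * (√(1 + q ^ (-2 * k)) : ℝ)) +
      Finsupp.single k (w * ((q : ℂ) * (Complex.exp (-(Complex.I * θ)) * (q : ℂ) ^ (-k)))) := by
  simp only [map_add, map_smul, rep_gen, genAct, LinearMap.add_apply, LinearMap.smul_apply,
    Finsupp.linearCombination_single, one_smul, Finsupp.smul_single, smul_eq_mul,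
    Complex.norm_exp_I_mul_ofReal, one_pow, one_mul, conj_exp_I_mul]

theorem rep_cd_single {q : ℝ} (hq : 0 < q) (θ : ℝ) (u w : ℂ) (k : ℤ) :
    rep hq (Complex.exp (Complex.I * θ)) (u • gen q Gen.c + w • gen q Gen.d)
      (Finsupp.single k 1) =
    Finsupp.single (k + -1) (w * (√(1 + q ^ (2 - 2 * k)) : ℝ)) +
      Finsupp.single k (u * (Complex.exp (Complex.I * θ) * (q : ℂ) ^ (-k))) := by
  simp only [map_add, map_smul, rep_gen, genAct, LinearMap.add_apply, LinearMap.smul_apply,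
    Finsupp.linearCombination_single, one_smul, Finsupp.smul_single, smul_eq_mul,
    Complex.norm_exp_I_mul_ofReal, one_pow, one_mul]
  rw [add_comm, ← sub_eq_add_neg]

theorem zpow_neg_sq (q : ℝ) (k : ℤ) : (q ^ (-k)) ^ 2 = q ^ (-2 * k) := by
  rw [← zpow_natCast, ← zpow_mul]; congr 1; push_cast; ring

theorem norm_sq_sqrt_weight {q : ℝ} (hq : 0 < q) (u : ℂ) (k : ℤ) :
    ‖u * (√(1 + q ^ k) : ℝ)‖ ^ 2 = ‖u‖ ^ 2 * (1 + q ^ k) := by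
  rw [norm_mul, mul_pow, Complex.norm_real, Real.norm_eq_abs, sq_abs, Real.sq_sqrt (by positivity)]

theorem norm_sq_zpow_weight {q : ℝ} {u z : ℂ} (hz : ‖z‖ = 1) (k : ℤ) :
    ‖u * (z * (q : ℂ) ^ (-k))‖ ^ 2 = ‖u‖ ^ 2 * q ^ (-2 * k) := by
  rw [norm_mul, norm_mul, hz, one_mul, mul_pow, ← Complex.ofReal_zpow, Complex.norm_real,
    Real.norm_eq_abs, sq_abs, zpow_neg_sq]

theorem ab_bounds {q : ℝ} (hq : 0 < q) (θ : ℝ) (u w : ℂ) (k : ℤ) :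
    ‖u * (√(1 + q ^ (-2 * k)) : ℝ)‖ ^ 2 ≤ (‖u‖ ^ 2 + ‖w * q‖ ^ 2) * (1 + q ^ (-2 * k)) ∧
    ‖w * ((q : ℂ) * (Complex.exp (-(Complex.I * θ)) * (q : ℂ) ^ (-k)))‖ ^ 2 ≤
      (‖u‖ ^ 2 + ‖w * q‖ ^ 2) * (1 + q ^ (-2 * k)) := by
  have h : 0 < q ^ (-2 * k) := zpow_pos hq _
  rw [norm_sq_sqrt_weight hq, ← mul_assoc w, norm_sq_zpow_weight (norm_exp_neg_I_mul θ)]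
  constructor <;> nlinarith [sq_nonneg ‖u‖, sq_nonneg ‖w * q‖]

theorem cd_bounds {q : ℝ} (hq : 0 < q) (hq1 : q < 1) (θ : ℝ) (u w : ℂ) (k : ℤ) :
    ‖w * (√(1 + q ^ (2 - 2 * k)) : ℝ)‖ ^ 2 ≤ (‖u‖ ^ 2 + ‖w‖ ^ 2) * (1 + q ^ (-2 * k)) ∧
    ‖u * (Complex.exp (Complex.I * θ) * (q : ℂ) ^ (-k))‖ ^ 2 ≤
      (‖u‖ ^ 2 + ‖w‖ ^ 2) * (1 + q ^ (-2 * k)) := by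
  have h : 0 < q ^ (-2 * k) := zpow_pos hq _
  have h1 : q ^ (2 - 2 * k) ≤ q ^ (-2 * k) :=
    zpow_le_zpow_right_of_le_one₀ hq hq1.le (by linarith)
  rw [norm_sq_sqrt_weight hq, norm_sq_zpow_weight (Complex.norm_exp_I_mul_ofReal θ)]
  constructor <;> nlinarith [sq_nonneg ‖u‖, sq_nonneg ‖w‖,
    mul_nonneg (sq_nonneg ‖w‖) (sub_nonneg.2 h1)]

theorem domain_ab {q : ℝ} (hq : 0 < q) (θ : ℝ) (u w : ℂ) :
    (piOp hq θ (u • gen q Gen.a + w • gen q Gen.b)).domain = DQ q :=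
  extend_domain 1 (rep_ab_single hq θ u w) (fun k => (ab_bounds hq θ u w k).1)
    fun k => (ab_bounds hq θ u w k).2

theorem domain_cd {q : ℝ} (hq : 0 < q) (hq1 : q < 1) (θ : ℝ) (u w : ℂ) :
    (piOp hq θ (u • gen q Gen.c + w • gen q Gen.d)).domain = DQ q :=
  extend_domain (-1) (rep_cd_single hq θ u w) (fun k => (cd_bounds hq hq1 θ u w k).1)
    fun k => (cd_bounds hq hq1 θ u w k).2

theorem coeffs_sub_one (q θ x t : ℝ) (m : ℤ) : coeffs q θ x t (m - 1) =
    Complex.exp (Complex.I * m * θ) * Complex.exp (-(Complex.I * θ)) * (V q (m - 1) x t : ℂ) := by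
  rw [coeffs, ← Complex.exp_add]; congr 2; push_cast; ring

theorem coeffs_add_one (q θ x t : ℝ) (m : ℤ) : coeffs q θ x t (m + 1) =
    Complex.exp (Complex.I * m * θ) * Complex.exp (Complex.I * θ) * (V q (m + 1) x t : ℂ) := by
  rw [coeffs, ← Complex.exp_add]; congr 2; push_cast; ring

theorem rpow_neg_half {q : ℝ} (hq : 0 < q) :
    q ^ (-1 / 2 : ℝ) = q ^ (1 / 2 : ℝ) * q⁻¹ := by
  rw [← Real.rpow_neg_one q, ← Real.rpow_add hq]; norm_num

theorem mapsVec_ab {q t s x x' r θ u w : ℝ} (hq : 0 < q) (hd : ofCoeffs (coeffs q θ x t) ∈ DQ q)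
    (hm : Memℓp (coeffs q θ x t) 2) (h' : r = 0 ∨ Memℓp (coeffs q θ x' s) 2)
    (h : ∀ k : ℤ, u * √(1 + q ^ (-2 * k)) * V q k x t + w * q * q ^ (-(k + 1)) * V q (k + 1) x t =
      r * V q (k + 1) x' s) :
    MapsVec (piOp hq θ ((u : ℂ) • gen q Gen.a + (w : ℂ) • gen q Gen.b))
      (ofCoeffs (coeffs q θ x t))
      ((Complex.exp (-(Complex.I * θ)) * (r : ℂ)) • ofCoeffs (coeffs q θ x' s)) := by
  refine mapsVec_ofCoeffs 1 (rep_ab_single hq θ u w) (fun k => (ab_bounds hq θ u w k).1)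
    (fun k => (ab_bounds hq θ u w k).2) hm hd (h'.imp_left fun h => by simp [h]) fun m => ?_
  -- The $m$-th coordinate of the image involves the indices $m-1$ and $m$, hence the recurrence at
  -- $m-1$.
  have e := congrArg (fun y : ℝ => (y : ℂ)) (h (m - 1))
  rw [sub_add_cancel] at e
  push_cast at e
  rw [coeffs_sub_one, coeffs, coeffs]
  linear_combination
    (Complex.exp (Complex.I * m * θ) * Complex.exp (-(Complex.I * θ))) * e

theorem mapsVec_cd {q t s x x' r θ u w : ℝ} (hq : 0 < q) (hq1 : q < 1)
    (hd : ofCoeffs (coeffs q θ x t) ∈ DQ q)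
    (hm : Memℓp (coeffs q θ x t) 2) (h' : Memℓp (coeffs q θ x' s) 2)
    (h : ∀ k : ℤ, u * q ^ (-k) * V q k x t + w * √(1 + q ^ (-2 * k)) * V q (k + 1) x t =
      r * V q k x' s) :
    MapsVec (piOp hq θ ((u : ℂ) • gen q Gen.c + (w : ℂ) • gen q Gen.d))
      (ofCoeffs (coeffs q θ x t))
      ((Complex.exp (Complex.I * θ) * (r : ℂ)) • ofCoeffs (coeffs q θ x' s)) := by
  refine mapsVec_ofCoeffs (-1) (rep_cd_single hq θ u w) (fun k => (cd_bounds hq hq1 θ u w k).1)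
    (fun k => (cd_bounds hq hq1 θ u w k).2) hm hd (Or.inr h') fun m => ?_
  have e := congrArg (fun y : ℝ => (y : ℂ)) (h m)
  have e1 : 2 - 2 * (m + 1) = -2 * m := by ring
  push_cast at e
  rw [sub_neg_eq_add, e1, coeffs_add_one, coeffs, coeffs]
  linear_combination
    (Complex.exp (Complex.I * m * θ) * Complex.exp (Complex.I * θ)) * e

section Generators

variable {q t x x' θ : ℝ}

theorem mapsVec_alphaInf (hq : 0 < q) (hq1 : q < 1) (ht : 1 < |t|) (hx : x ≠ 0)
    (hx' : x' = x * q⁻¹) {r : ℝ} (hr : r = (1 + x * t) / (1 - q ^ 2 * t ^ (-2 : ℤ)))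
    (hd : ofCoeffs (coeffs q θ x t) ∈ DQ q) (hm : Memℓp (coeffs q θ x t) 2)
    (h' : r = 0 ∨ Memℓp (coeffs q θ x' (t * q⁻¹)) 2) :
    MapsVec (piOp hq θ (alphaInf q t)) (ofCoeffs (coeffs q θ x t))
      (((q ^ (1 / 2 : ℝ) : ℝ) * Complex.exp (-(Complex.I * θ)) * (t : ℂ)⁻¹ * (r : ℝ) : ℂ) •
        ofCoeffs (coeffs q θ x' (t * q⁻¹))) := by
  have key := mapsVec_ab (r := q ^ (1 / 2 : ℝ) * t⁻¹ * r) (u := q ^ (1 / 2 : ℝ))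
    (w := q ^ (-1 / 2 : ℝ) * t) hq hd hm (h'.imp_left fun h => by rw [h, mul_zero]) fun k => by
      rw [rpow_neg_half hq, hr, hx', mul_assoc (q ^ (1 / 2 : ℝ)) t⁻¹,
        mul_assoc (q ^ (1 / 2 : ℝ)) (t⁻¹ * _),
        ← V_action_alpha hq hq1 hx (hq1.trans ht) k]
      field_simp
  have e : ((q ^ (1 / 2 : ℝ) : ℝ) * Complex.exp (-(Complex.I * θ)) * (t : ℂ)⁻¹ * (r : ℝ) : ℂ) =
      Complex.exp (-(Complex.I * θ)) *
      ((q ^ (1 / 2 : ℝ) * t⁻¹ * r : ℝ) : ℂ) := by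
    push_cast; ring
  rw [e]
  exact key

theorem mapsVec_betaInf (hq : 0 < q) (hq1 : q < 1) (ht : 1 < |t|) (hx : x ≠ 0)
    (hx' : x' = x * q⁻¹)
    (hd : ofCoeffs (coeffs q θ x t) ∈ DQ q) (hm : Memℓp (coeffs q θ x t) 2)
    (h' : Memℓp (coeffs q θ x' (t * q)) 2) :
    MapsVec (piOp hq θ (betaInf q t)) (ofCoeffs (coeffs q θ x t))
      ((-(t : ℂ) ^ 2 * (q ^ (1 / 2 : ℝ) : ℝ) * Complex.exp (-(Complex.I * θ)) *
        (1 - t ^ (-2 : ℤ) : ℝ) : ℂ) • ofCoeffs (coeffs q θ x' (t * q))) := by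
  have key := mapsVec_ab (r := q ^ (1 / 2 : ℝ) * (-t ^ 2 * (1 - t ^ (-2 : ℤ))))
    (u := q ^ (1 / 2 : ℝ) * t) (w := q ^ (-1 / 2 : ℝ)) hq hd hm (Or.inr h') fun k => by
      rw [rpow_neg_half hq, hx', mul_assoc (q ^ (1 / 2 : ℝ)) (-t ^ 2 * _),
        ← V_action_beta hq hq1 hx ht k]
      field_simp
  have e : (-(t : ℂ) ^ 2 * (q ^ (1 / 2 : ℝ) : ℝ) * Complex.exp (-(Complex.I * θ)) *
      (1 - t ^ (-2 : ℤ) : ℝ) : ℂ) =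
      Complex.exp (-(Complex.I * θ)) *
      ((q ^ (1 / 2 : ℝ) * (-t ^ 2 * (1 - t ^ (-2 : ℤ))) : ℝ) : ℂ) := by
    push_cast; ring
  rw [e]
  exact key

theorem mapsVec_gammaInf (hq : 0 < q) (hq1 : q < 1) (ht : 1 < |t|) (hx : x ≠ 0)
    (hx' : x' = x * q) {r : ℝ} (hr : r = (1 + q ^ 2 * x * t⁻¹) / (1 - q ^ 2 * t ^ (-2 : ℤ)))
    (hd : ofCoeffs (coeffs q θ x t) ∈ DQ q) (hm : Memℓp (coeffs q θ x t) 2)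
    (h' : Memℓp (coeffs q θ x' (t * q⁻¹)) 2) :
    MapsVec (piOp hq θ (gammaInf q t)) (ofCoeffs (coeffs q θ x t))
      ((-(q ^ (1 / 2 : ℝ) : ℝ) * Complex.exp (Complex.I * θ) * (r : ℝ) : ℂ) •
        ofCoeffs (coeffs q θ x' (t * q⁻¹))) := by
  have key := mapsVec_cd (r := q ^ (1 / 2 : ℝ) * -r) (u := q ^ (1 / 2 : ℝ))
    (w := q ^ (-1 / 2 : ℝ) * t) hq hq1 hd hm h' fun k => by
      rw [rpow_neg_half hq, hr, hx', mul_assoc (q ^ (1 / 2 : ℝ)) (-_),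
        ← V_action_gamma hq hq1 hx (hq1.trans ht) k]
      ring
  have e : (-(q ^ (1 / 2 : ℝ) : ℝ) * Complex.exp (Complex.I * θ) * (r : ℝ) : ℂ) =
      Complex.exp (Complex.I * θ) *
      ((q ^ (1 / 2 : ℝ) * -r : ℝ) : ℂ) := by
    push_cast; ring
  rw [e]
  exact key

theorem mapsVec_deltaInf (hq : 0 < q) (hq1 : q < 1) (ht : 1 < |t|) (hx : x ≠ 0)
    (hx' : x' = x * q)
    (hd : ofCoeffs (coeffs q θ x t) ∈ DQ q) (hm : Memℓp (coeffs q θ x t) 2)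
    (h' : Memℓp (coeffs q θ x' (t * q)) 2) :
    MapsVec (piOp hq θ (deltaInf q t)) (ofCoeffs (coeffs q θ x t))
      ((Complex.exp (Complex.I * θ) * t * (q ^ (1 / 2 : ℝ) : ℝ) *
        (1 - t ^ (-2 : ℤ) : ℝ) : ℂ) • ofCoeffs (coeffs q θ x' (t * q))) := by
  have key := mapsVec_cd (r := q ^ (1 / 2 : ℝ) * (t * (1 - t ^ (-2 : ℤ))))
    (u := q ^ (1 / 2 : ℝ) * t) (w := q ^ (-1 / 2 : ℝ)) hq hq1 hd hm h' fun k => by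
      rw [rpow_neg_half hq, hx', mul_assoc (q ^ (1 / 2 : ℝ)) (t * _),
        ← V_action_delta hq hq1 hx ht k]
      ring
  have e : (Complex.exp (Complex.I * θ) * t * (q ^ (1 / 2 : ℝ) : ℝ) *
      (1 - t ^ (-2 : ℤ) : ℝ) : ℂ) =
      Complex.exp (Complex.I * θ) *
      ((q ^ (1 / 2 : ℝ) * (t * (1 - t ^ (-2 : ℤ))) : ℝ) : ℂ) := by
    push_cast; ring
  rw [e]
  exact key

end Generators

end QSU11

end

theorem proposition4p4 (q : ℝ) (hq : 0 < q) (hq1 : q < 1) (t : ℝ) (ht : 1 < |t|) (θ : ℝ) :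
    -- the sequences defining the vectors `v^θ_p(s)`, `w^θ_p(s)`, `|s| > q`, are square summable
    (∀ s : ℝ, q < |s| →
      (∀ p : ℕ, Memℓp (QSU11.coeffs q θ (-q ^ (2 * (p : ℤ)) * s⁻¹) s) 2) ∧
      (∀ p : ℤ, Memℓp (QSU11.coeffs q θ (q ^ (2 * p) * s) s) 2)) ∧
    -- the four operators are defined on `𝒟(Q)`
    (QSU11.piOp hq θ (QSU11.alphaInf q t)).domain = QSU11.DQ q ∧
    (QSU11.piOp hq θ (QSU11.betaInf q t)).domain = QSU11.DQ q ∧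
    (QSU11.piOp hq θ (QSU11.gammaInf q t)).domain = QSU11.DQ q ∧
    (QSU11.piOp hq θ (QSU11.deltaInf q t)).domain = QSU11.DQ q ∧
    -- the vectors lie in `𝒟(Q)`
    (∀ p : ℕ, QSU11.v q θ p t ∈ QSU11.DQ q) ∧
    (∀ p : ℤ, QSU11.w q θ p t ∈ QSU11.DQ q) ∧
    -- action of `α_{∞,t}`
    (∀ p : ℕ, QSU11.MapsVec (QSU11.piOp hq θ (QSU11.alphaInf q t)) (QSU11.v q θ p t)
      (((q ^ (1 / 2 : ℝ) : ℝ) * Complex.exp (-(Complex.I * θ)) * (t : ℂ)⁻¹ *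
        ((1 - q ^ (2 * p)) / (1 - q ^ 2 * t ^ (-2 : ℤ)) : ℝ) : ℂ) •
          QSU11.v q θ ((p : ℤ) - 1) (t * q⁻¹))) ∧
    (∀ p : ℤ, QSU11.MapsVec (QSU11.piOp hq θ (QSU11.alphaInf q t)) (QSU11.w q θ p t)
      (((q ^ (1 / 2 : ℝ) : ℝ) * Complex.exp (-(Complex.I * θ)) * (t : ℂ)⁻¹ *
        ((1 + t ^ 2 * q ^ (2 * p)) / (1 - q ^ 2 * t ^ (-2 : ℤ)) : ℝ) : ℂ) •
          QSU11.w q θ p (t * q⁻¹))) ∧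
    -- action of `β_{∞,t}`
    (∀ p : ℕ, QSU11.MapsVec (QSU11.piOp hq θ (QSU11.betaInf q t)) (QSU11.v q θ p t)
      ((-(t : ℂ) ^ 2 * (q ^ (1 / 2 : ℝ) : ℝ) * Complex.exp (-(Complex.I * θ)) *
        (1 - t ^ (-2 : ℤ) : ℝ) : ℂ) • QSU11.v q θ p (t * q))) ∧
    (∀ p : ℤ, QSU11.MapsVec (QSU11.piOp hq θ (QSU11.betaInf q t)) (QSU11.w q θ p t)
      ((-(t : ℂ) ^ 2 * (q ^ (1 / 2 : ℝ) : ℝ) * Complex.exp (-(Complex.I * θ)) *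
        (1 - t ^ (-2 : ℤ) : ℝ) : ℂ) • QSU11.w q θ (p - 1) (t * q))) ∧
    -- action of `γ_{∞,t}`
    (∀ p : ℕ, QSU11.MapsVec (QSU11.piOp hq θ (QSU11.gammaInf q t)) (QSU11.v q θ p t)
      ((-(q ^ (1 / 2 : ℝ) : ℝ) * Complex.exp (Complex.I * θ) *
        ((1 - q ^ (2 + 2 * p) * t ^ (-2 : ℤ)) / (1 - q ^ 2 * t ^ (-2 : ℤ)) : ℝ) : ℂ) •
          QSU11.v q θ p (t * q⁻¹))) ∧
    (∀ p : ℤ, QSU11.MapsVec (QSU11.piOp hq θ (QSU11.gammaInf q t)) (QSU11.w q θ p t)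
      ((-(q ^ (1 / 2 : ℝ) : ℝ) * Complex.exp (Complex.I * θ) *
        ((1 + q ^ (2 + 2 * p)) / (1 - q ^ 2 * t ^ (-2 : ℤ)) : ℝ) : ℂ) •
          QSU11.w q θ (p + 1) (t * q⁻¹))) ∧
    -- action of `δ_{∞,t}`
    (∀ p : ℕ, QSU11.MapsVec (QSU11.piOp hq θ (QSU11.deltaInf q t)) (QSU11.v q θ p t)
      ((Complex.exp (Complex.I * θ) * t * (q ^ (1 / 2 : ℝ) : ℝ) *
        (1 - t ^ (-2 : ℤ) : ℝ) : ℂ) • QSU11.v q θ ((p : ℤ) + 1) (t * q))) ∧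
    (∀ p : ℤ, QSU11.MapsVec (QSU11.piOp hq θ (QSU11.deltaInf q t)) (QSU11.w q θ p t)
      ((Complex.exp (Complex.I * θ) * t * (q ^ (1 / 2 : ℝ) : ℝ) *
        (1 - t ^ (-2 : ℤ) : ℝ) : ℂ) • QSU11.w q θ p (t * q))) := by
  have ht0 : t ≠ 0 := abs_pos.1 (one_pos.trans ht)
  have hqt : q < |t| := hq1.trans ht
  -- The condition $|t|>1$ is exactly what keeps $tq$ in the range $|s|>q$.
  have hqt1 : q < |t * q| := by
    rw [abs_mul, abs_of_pos hq]; exact lt_mul_of_one_lt_left hq ht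
  have hqt2 : q < |t * q⁻¹| := by
    rw [abs_mul, abs_of_pos (inv_pos.2 hq)]
    exact hqt.trans (lt_mul_of_one_lt_right (hq.trans hqt) ((one_lt_inv₀ hq).2 hq1))
  have hv : ∀ s : ℝ, q < |s| → ∀ p : ℕ,
      Memℓp (QSU11.coeffs q θ (-q ^ (2 * (p : ℤ)) * s⁻¹) s) 2 := fun s hs p =>
    QSU11.memℓp_coeffs θ hq hq1 hs (QSU11.growth_v hq hq1 hs p)
  have hw : ∀ s : ℝ, q < |s| → ∀ p : ℤ,
      Memℓp (QSU11.coeffs q θ (q ^ (2 * p) * s) s) 2 := fun s hs p =>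
    QSU11.memℓp_coeffs θ hq hq1 hs (QSU11.growth_w hq hq1 hs p)
  have hvD : ∀ p : ℕ, QSU11.v q θ p t ∈ QSU11.DQ q := fun p =>
    QSU11.ofCoeffs_mem_DQ θ hq hq1 ht (QSU11.growth_v hq hq1 hqt p)
  have hwD : ∀ p : ℤ, QSU11.w q θ p t ∈ QSU11.DQ q := fun p =>
    QSU11.ofCoeffs_mem_DQ θ hq hq1 ht (QSU11.growth_w hq hq1 hqt p)
  have hxv : ∀ p : ℕ, -q ^ (2 * (p : ℤ)) * t⁻¹ ≠ 0 := fun p =>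
    mul_ne_zero (neg_ne_zero.2 (zpow_ne_zero _ hq.ne')) (inv_ne_zero ht0)
  have hxw : ∀ p : ℤ, q ^ (2 * p) * t ≠ 0 := fun p => mul_ne_zero (zpow_ne_zero _ hq.ne') ht0
  have hzp : ∀ p : ℕ, q ^ (2 * p) = q ^ (2 * (p : ℤ)) := fun p => by norm_cast
  have hsub : ∀ p : ℤ, q ^ (2 * (p - 1)) = q ^ (2 * p) * q⁻¹ * q⁻¹ := fun p => by
    rw [← zpow_sub_one₀ hq.ne', ← zpow_sub_one₀ hq.ne']; congr 1; ring
  have hadd : ∀ p : ℤ, q ^ (2 * (p + 1)) = q ^ (2 * p) * q * q := fun p => by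
    rw [← zpow_add_one₀ hq.ne', ← zpow_add_one₀ hq.ne']; congr 1; ring
  refine ⟨fun s hs => ⟨hv s hs, hw s hs⟩, QSU11.domain_ab hq θ _ _, QSU11.domain_ab hq θ _ _,
    QSU11.domain_cd hq hq1 θ _ _, QSU11.domain_cd hq hq1 θ _ _, hvD, hwD,
    fun p => ?_, fun p => ?_, fun p => ?_, fun p => ?_, fun p => ?_, fun p => ?_, fun p => ?_,
    fun p => ?_⟩
  · refine QSU11.mapsVec_alphaInf hq hq1 ht (hxv p) ?_ ?_ (hvD p) (hv t hqt p) ?_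
    · rw [hsub]; field_simp
    · rw [inv_mul_cancel_right₀ ht0, hzp]; ring
    · rcases p with - | p
      -- For $p=0$ the factor $1-q^{2p}$ vanishes, so the target with index $-1$ is irrelevant.
      · left; simp
      · right
        have e : ((p + 1 : ℕ) : ℤ) - 1 = p := by push_cast; ring
        rw [e]
        exact hv _ hqt2 p
  · refine QSU11.mapsVec_alphaInf hq hq1 ht (hxw p) ?_ ?_ (hwD p) (hw t hqt p)
      (Or.inr (hw _ hqt2 p))
    · ring
    · ring
  · refine QSU11.mapsVec_betaInf hq hq1 ht (hxv p) ?_ (hvD p) (hv t hqt p) (hv _ hqt1 p)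
    field_simp
  · refine QSU11.mapsVec_betaInf hq hq1 ht (hxw p) ?_ (hwD p) (hw t hqt p) (hw _ hqt1 (p - 1))
    rw [hsub]; field_simp
  · refine QSU11.mapsVec_gammaInf hq hq1 ht (hxv p) ?_ ?_ (hvD p) (hv t hqt p) (hv _ hqt2 p)
    · field_simp
    · rw [pow_add, hzp, zpow_neg]; norm_cast; field_simp; ring
  · refine QSU11.mapsVec_gammaInf hq hq1 ht (hxw p) ?_ ?_ (hwD p) (hw t hqt p)
      (hw _ hqt2 (p + 1))
    · rw [hadd]; field_simp
    · rw [zpow_add₀ hq.ne', ← mul_assoc, mul_inv_cancel_right₀ ht0]; norm_cast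
  · refine QSU11.mapsVec_deltaInf hq hq1 ht (hxv p) ?_ (hvD p) (hv t hqt p) ?_
    · rw [hadd]; field_simp
    · exact_mod_cast hv _ hqt1 (p + 1)
  · refine QSU11.mapsVec_deltaInf hq hq1 ht (hxw p) ?_ (hwD p) (hw t hqt p) (hw _ hqt1 p)
    ring
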